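/- Let $n\ge 1$ be an integer. Put $L=\begin{pmatrix}1&0\\1&1\end{pmatrix}$, $R=\begin{pmatrix}1&1\\0&1\end{pmatrix}$ and identify a finite word over $\{L,R\}$ with the product of its letters. Let $\mathcal D_n$ be the set of $2\times 2$ matrices with nonnegative integer entries, determinant $n$ and coprime entries; let $\mathcal{RB}_n$ be the set of $\begin{pmatrix}a&b\\c&d\end{pmatrix}\in\mathcal D_n$ with $a>c$ and $d>b$, and let $\mathcal{DB}_n$ be the set of those elements of $\mathcal{RB}_n$ with moreover $a>b$ and $d>c$. Raney's transducer $\mathcal T_n$ has the set of states $\mathcal{DB}_n$; it has a transition from $M$ to $N$ with input word $V$ and output word $W$ if $MV=WN$, $MV\notin\mathcal{RB}_n$, and $MV_1\in\mathcal{RB}_n$ for every proper prefix $V_1$ of $V$. A walk is a finite sequence of consecutive transitions; its input (output) word is the concatenation of those of its transitions, and we write $M\xrightarrow{V|W}N$ for a walk from $M$ to $N$ with input word $V$ and output word $W$. A walk with equal first and last state is closed, and the $m$-th power of a closed walk is the walk that traverses it $m$ times. The word $\overline V$ associated to $V$ is obtained by exchanging the letters $L$ and $R$, and the matrix associated to $M=\begin{pmatrix}a&b\\c&d\end{pmatrix}$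 is $\overline M=\begin{pmatrix}d&c\\b&a\end{pmatrix}$. A closed walk $M\xrightarrow{V|W}M$ is symmetric if it is the concatenation of a walk from $M$ to $\overline M$ with some input word $V_1$ and a walk from $\overline M$ to $M$ with input word $\overline{V_1}$. Let $\sigma(V)$ be the number of runs (maximal blocks of equal letters) of $V$, let $\tau(V)$ be the set of conjugates (cyclic shifts) of $V$, and let $\sigma_c(V)=\min\{\sigma(V'):V'\in\tau(V)\}$. Let $\kappa(V)$ be the word obtained from $V$ by replacing each run, of length $i$ say, with a run of the same letter of the length $i'\in\{4n,\dots,5n-1\}$ such that $i'\equiv i\pmod n$. For nonempty $V$ put $\tau_\kappa(V)=\tau(\kappa(V'))$, where $V'\in\tau(V)$ and $\sigma(V')=\sigma_c(V)$ (this does not depend on the choice of $V'$). **Theorem.** Let $M\xrightarrow{V|W}M$ be a closed walk in $\mathcal T_n$ with $V$ nonempty. There exist $\widehat V\in\tau_\kappa(V)$, a state $\widehat M\in\mathcal{DB}_n$ and a closed walk $\widehat M\xrightarrow{\widehat V|\widehat W}\widehat M$ in $\mathcal T_n$ such that $\sigma_c(\widehat W)\ge\sigma_c(W)$ and, moreover: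 (a) suppose that both letters $L$ and $R$ occur in $V$; if $V=V_1^{m_1}$ for some word $V_1$ and some $m_1\ge 2$, and the walk $\widehat M\xrightarrow{\widehat V|\widehat W}\widehat M$ is the $m_1$-th power of a closed walk $\widehat M\xrightarrow{\widehat V_1|\widehat W_1}\widehat M$ (so that $\widehat V_1^{m_1}=\widehat V$ and $\widehat W_1^{m_1}=\widehat W$), then the walk $M\xrightarrow{V|W}M$ is the $m_2$-th power of a closed walk $M\xrightarrow{V_2|W_2}M$ for some $m_2\ge 2$ (so that $V_2^{m_2}=V$ and $W_2^{m_2}=W$); (b) if $V=V_1\overline{V_1}$ for some word $V_1$ and the walk $\widehat M\xrightarrow{\widehat V|\widehat W}\widehat M$ is symmetric, then the walk $M\xrightarrow{V|W}M$ is symmetric. -/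

import Mathlib

namespace Raney

/-- The two letters of the alphabet `{L, R}`. -/
inductive Letter : Type
  | L
  | R
  deriving DecidableEq

/-- Finite words over `{L, R}`. -/
abbrev Word : Type := List Letter

/-- `2 × 2` matrices with nonnegative integer entries. -/
abbrev Mat : Type := Matrix (Fin 2) (Fin 2) ℕ

/-! ### Words -/

/-- The power `V ^ m` of a word (more generally, of a list): `m` consecutive copies of `V`. -/
def wordPow {α : Type*} (V : List α) (m : ℕ) : List α := (List.replicate m V).flatten

/-- The letter exchanged with the other one. -/
def Letter.swap : Letter → Letter
  | Letter.L => Letter.R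
  | Letter.R => Letter.L

/-- The word associated to `V`: the letters `L` and `R` are exchanged. -/
def assocWord (V : Word) : Word := V.map Letter.swap

/-- The list of the runs of `V` (maximal blocks of equal letters), in order. -/
def runs (V : Word) : List Word := V.splitBy (fun x y => decide (x = y))

/-- `σ(V)`: the number of runs of `V`. -/
def runCount (V : Word) : ℕ := (runs V).length

/-- `τ(V)`: the set of all conjugates (cyclic shifts) of `V`. -/
def conjugates (V : Word) : Set Word := {V' | V.IsRotated V'}

/-- `σ_c(V)`: the minimum of `σ(V')` over the conjugates `V'` of `V`.
The infimum is a minimum, since `V` is a conjugate of itself. -/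
noncomputable def cyclicRunCount (V : Word) : ℕ := sInf (runCount '' conjugates V)

/-- A nonempty run of length `i` is replaced with the run of the same letter whose length is
the element of `{4n, …, 5n - 1}` congruent to `i` modulo `n`. -/
def resizeRun (n : ℕ) : Word → Word
  | [] => []
  | a :: r => List.replicate (4 * n + (a :: r).length % n) a

/-- `κ(V)`: all the runs of `V` are resized. -/
def kappa (n : ℕ) (V : Word) : Word := ((runs V).map (resizeRun n)).flatten

/-- `τ_κ(V)`: the conjugates of `κ(V')`, where `V'` is a conjugate of `V` with
`σ(V') = σ_c(V)`. -/
def tauKappa (n : ℕ) (V : Word) : Set Word :=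
  {U | ∃ V' ∈ conjugates V, runCount V' = cyclicRunCount V ∧ U ∈ conjugates (kappa n V')}

/-! ### Matrices -/

/-- The matrix of a letter. -/
def Letter.toMat : Letter → Mat
  | Letter.L => !![1, 0; 1, 1]
  | Letter.R => !![1, 1; 0, 1]

/-- The matrix `μ(V)` of a word `V`: the product of the matrices of its letters. -/
def wordMat (V : Word) : Mat := (V.map Letter.toMat).prod

/-- The associated matrix: both the rows and the columns are exchanged. -/
def assocMat (M : Mat) : Mat := !![M 1 1, M 1 0; M 0 1, M 0 0]

/-- The set `D_n` of matrices with nonnegative integer entries, determinant `n` and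
coprime entries. -/
def IsD (n : ℕ) (M : Mat) : Prop :=
  (M.map (Nat.cast : ℕ → ℤ)).det = (n : ℤ) ∧
    Nat.gcd (Nat.gcd (M 0 0) (M 0 1)) (Nat.gcd (M 1 0) (M 1 1)) = 1

/-- The row-balanced matrices in `D_n`. -/
def IsRB (n : ℕ) (M : Mat) : Prop := IsD n M ∧ M 1 0 < M 0 0 ∧ M 0 1 < M 1 1

/-- The column-balanced matrices in `D_n`. -/
def IsCB (n : ℕ) (M : Mat) : Prop := IsD n M ∧ M 0 1 < M 0 0 ∧ M 1 0 < M 1 1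

/-- The doubly balanced matrices in `D_n`: the states of the transducer `T_n`. -/
def IsDB (n : ℕ) (M : Mat) : Prop := IsRB n M ∧ IsCB n M

/-! ### The transducer `T_n` and its walks -/

/-- The data of a transition: starting state, input word, output word, ending state. -/
structure Transition where
  src : Mat
  input : Word
  output : Word
  tgt : Mat

/-- The transitions of `T_n`. -/
def IsTransition (n : ℕ) (e : Transition) : Prop :=
  IsDB n e.src ∧ IsDB n e.tgt ∧
    e.src * wordMat e.input = wordMat e.output * e.tgt ∧
    ¬ IsRB n (e.src * wordMat e.input) ∧
    ∀ V₁ : Word, V₁ <+: e.input → V₁ ≠ e.input → IsRB n (e.src * wordMat V₁)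

/-- `IsWalk n M C N`: the list of transitions `C` is a walk in `T_n` from `M` to `N`
(the empty walk is allowed). -/
inductive IsWalk (n : ℕ) : Mat → List Transition → Mat → Prop
  | nil (M : Mat) (hM : IsDB n M) : IsWalk n M [] M
  | cons (e : Transition) (C : List Transition) (N : Mat) (he : IsTransition n e)
      (hC : IsWalk n e.tgt C N) : IsWalk n e.src (e :: C) N

/-- The input word of a walk: the concatenation of the input words of its transitions. -/
def inputWord (C : List Transition) : Word := (C.map Transition.input).flatten

/-- The output word of a walk: the concatenation of the output words of its transitions. -/
def outputWord (C : List Transition) : Word := (C.map Transition.output).flatten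

/-- The closed walk `C` from `M` to `M` is symmetric: it consists of a walk from `M` to the
associated state with some input word `V₁`, followed by a walk back to `M` whose input word is
the word associated to `V₁`. -/
def IsSymmetricClosedWalk (n : ℕ) (M : Mat) (C : List Transition) : Prop :=
  ∃ C₁ C₂ : List Transition, C = C₁ ++ C₂ ∧
    IsWalk n M C₁ (assocMat M) ∧ IsWalk n (assocMat M) C₂ M ∧
    inputWord C₂ = assocWord (inputWord C₁)

end Raney

/-!
A walk of `T_n` from `M` to `N` is the same thing as an identity `M V = W N` between states
(`exists_walk`, `IsWalk.eq_of_inputWord_eq`): a nonnegative matrix of positive determinant factors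
uniquely as a word times a row-balanced matrix (`exists_wordMat_mul_rowBalanced`,
`wordMat_mul_rowBalanced_unique`). So a closed walk with input `V` through `M` amounts to the
assertion that `M V M⁻¹` is a word `W`. In particular it lies in `SL₂(ℤ)`, that is, `V` fixes the
coset `SL₂(ℤ) M`. The action of `V` on these cosets depends only on the run lengths
modulo `n` (`leftEquiv_mul_kappa`). Conversely, if `V` contains both letters and fixes the coset
of `K`, and some representative of that coset conjugates `V` to a word, then so does some state of
the transducer, up to rotations (`HasOutput.exists_state`). The reason is a discrete form of the
contraction to Perron eigenvectors (`exists_mul_pow_nonneg`), which also shows that a word with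
both letters is determined up to rotation by its conjugacy class in `SL₂(ℤ)`
(`isRotated_of_conj`).

The number of cyclic runs of the output is compared one run at a time (`HasOutput.resize_L`). Let
the input be `L ^ i Y`. Choose a lower triangular representative `T` of the coset; then
`T L ^ n = L ^ (d ^ 2) T`, where `d = T 1 1`. The output is conjugate to `L ^ j A₀` for a word
`A₀ = R … R` that does not depend on `i` within its class modulo `n`, and adding `n` to `i` adds
`d ^ 2` to `j`. Since the trace exceeds two, `j ≥ -1` for each `i > 0`; hence `j ≥ 1` for
`i ≥ 4 n`. For `j ≥ 1` the number of cyclic changes of letters is that of the word `L A₀`, for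
`j = 0` it is that of `A₀`, and for `j = -1` the matrix `L⁻¹ A₀` is conjugate to a word obtained
from `A₀` by deleting letters (`exists_conj_quarterTurn_mul`). Deletions do not increase the
number of changes (`cyclicChanges_le_of_sublist`).

For the statements on powers and on symmetric walks, the corresponding property of the new walk
says that `V₁` fixes the coset of `M`, or maps it to the coset of the associated matrix
(`leftEquiv_of_pow`, `leftEquiv_of_symmetric`). Then `M V₁ = A M` or `M V₁ = A (assocMat M)` with
`A ∈ SL₂(ℤ)`, and `A ^ m`, respectively `A * flip A`, is the nonnegative matrix of `W`. This forces
`A` itself to be nonnegative (`nonneg_of_pow_nonneg`, `nonneg_of_mul_flip_nonneg`), hence a word.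
-/

namespace Raney

/-! ### Letter changes in words -/

@[simp] theorem Letter.swap_swap (a : Letter) : a.swap.swap = a := by cases a <;> rfl

theorem Letter.swap_ne (a : Letter) : a.swap ≠ a := by cases a <;> decide

theorem Letter.eq_swap_of_ne {a b : Letter} (h : a ≠ b) : b = a.swap := by
  cases a <;> cases b <;> first | rfl | exact absurd rfl h

@[simp] theorem assocWord_nil : assocWord [] = [] := rfl

@[simp] theorem assocWord_cons (a : Letter) (V : Word) :
    assocWord (a :: V) = a.swap :: assocWord V := rfl

@[simp] theorem assocWord_append (U V : Word) :
    assocWord (U ++ V) = assocWord U ++ assocWord V := List.map_append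

@[simp] theorem assocWord_assocWord (V : Word) : assocWord (assocWord V) = V := by
  induction V with
  | nil => rfl
  | cons a t ih => simp [ih]

@[simp] theorem length_assocWord (V : Word) : (assocWord V).length = V.length :=
  List.length_map ..

/-- The number of indices at which the letter changes in the word `a :: w`. -/
def changesFrom : Letter → Word → ℕ
  | _, [] => 0
  | a, b :: t => (if a = b then 0 else 1) + changesFrom b t

/-- The number of letter changes in a word read cyclically. -/
def cyclicChanges : Word → ℕ
  | [] => 0
  | a :: t => changesFrom a (t ++ [a])

theorem changesFrom_append_cons (a b : Letter) (u v : Word) :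
    changesFrom a (u ++ b :: v) = changesFrom a (u ++ [b]) + changesFrom b v := by
  induction u generalizing a with
  | nil => simp [changesFrom]
  | cons c u ih => simp only [List.cons_append, changesFrom, ih c]; omega

theorem changesFrom_le_add (a b : Letter) (w : Word) :
    changesFrom a w ≤ (if a = b then 0 else 1) + changesFrom b w := by
  cases w with
  | nil => simp [changesFrom]
  | cons c w =>
    simp only [changesFrom]
    cases a <;> cases b <;> cases c <;> simp <;> omega

theorem changesFrom_concat_le_add (a b c : Letter) (w : Word) :
    changesFrom a (w ++ [b]) ≤ changesFrom a (w ++ [c]) + (if c = b then 0 else 1) := by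
  induction w generalizing a with
  | nil =>
    simp only [List.nil_append, changesFrom]
    cases a <;> cases b <;> cases c <;> simp
  | cons d w ih =>
    simp only [List.cons_append, changesFrom]
    have := ih d
    omega

theorem changesFrom_concat_le_of_sublist {u v : Word} (h : u.Sublist v) (a c : Letter) :
    changesFrom a (u ++ [c]) ≤ changesFrom a (v ++ [c]) := by
  induction h generalizing a with
  | slnil => rfl
  | cons b _ ih =>
    simp only [List.cons_append, changesFrom]
    exact (changesFrom_le_add a b _).trans (Nat.add_le_add_left (ih b) _)
  | cons_cons b _ ih =>
    simp only [List.cons_append, changesFrom]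
    exact Nat.add_le_add_left (ih b) _

/-- Deleting letters does not increase the number of cyclic changes. -/
theorem cyclicChanges_le_of_sublist {u v : Word} (h : u.Sublist v) :
    cyclicChanges u ≤ cyclicChanges v := by
  induction h with
  | slnil => rfl
  | @cons u v b _ ih =>
    refine ih.trans ?_
    cases v with
    | nil => simp [cyclicChanges]
    | cons c w =>
      simp only [cyclicChanges, List.cons_append, changesFrom]
      have := changesFrom_concat_le_add c c b w
      omega
  | cons_cons b h _ => exact changesFrom_concat_le_of_sublist h b b

theorem cyclicChanges_eq_of_isRotated {u v : Word} (h : u ~r v) :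
    cyclicChanges u = cyclicChanges v := by
  obtain ⟨k, rfl⟩ := h
  induction k generalizing u with
  | zero => simp
  | succ k ih =>
    cases u with
    | nil => simp
    | cons a t =>
      rw [List.rotate_cons_succ, ← ih]
      cases t with
      | nil => rfl
      | cons b t =>
        simp only [cyclicChanges, List.cons_append, changesFrom, List.append_assoc]
        rw [List.nil_append, changesFrom_append_cons b a t [b]]
        simp only [changesFrom]
        cases a <;> cases b <;> simp [add_comm]

theorem cyclicChanges_cons_cons (a : Letter) (t : Word) :
    cyclicChanges (a :: a :: t) = cyclicChanges (a :: t) := by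
  simp only [cyclicChanges, List.cons_append, changesFrom]
  simp

theorem cyclicChanges_replicate_append (a : Letter) (k : ℕ) (t : Word) :
    cyclicChanges (List.replicate (k + 1) a ++ t) = cyclicChanges (a :: t) := by
  induction k with
  | zero => simp
  | succ k ih =>
    rw [← ih, List.replicate_succ, List.replicate_succ, List.cons_append, List.cons_append,
      cyclicChanges_cons_cons]

theorem cyclicChanges_assocWord (w : Word) :
    cyclicChanges (assocWord w) = cyclicChanges w := by
  have key : ∀ (a : Letter) (w : Word),
      changesFrom a.swap (assocWord w) = changesFrom a w := by
    intro a w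
    induction w generalizing a with
    | nil => rfl
    | cons b w ih =>
      simp only [assocWord_cons, changesFrom, ih]
      cases a <;> cases b <;> simp [Letter.swap]
  cases w with
  | nil => rfl
  | cons a t =>
    have := key a (t ++ [a])
    simpa [cyclicChanges] using this

/-! ### Runs -/

theorem runCount_cons (a : Letter) (t : Word) : runCount (a :: t) = 1 + changesFrom a t := by
  have key : ∀ (l : Word) (a : Letter) (g : Word) (gs : List Word),
      (List.splitBy.loop (fun x y : Letter => decide (x = y)) l a g gs).length
        = gs.length + 1 + changesFrom a l := by
    intro l
    induction l with
    | nil => intro a g gs; simp [List.splitBy.loop, changesFrom]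
    | cons b l ih =>
      intro a g gs
      by_cases h : a = b
      · subst h
        simp [List.splitBy.loop, ih, changesFrom]
      · simp [List.splitBy.loop, h, ih, changesFrom]
        omega
  have := key t a [] []
  simpa [runCount, runs, List.splitBy] using this

theorem cyclicChanges_le_runCount (w : Word) : cyclicChanges w ≤ runCount w := by
  cases w with
  | nil => simp [cyclicChanges]
  | cons a t =>
    rw [runCount_cons]
    simp only [cyclicChanges]
    rcases List.eq_nil_or_concat' t with rfl | ⟨s, b, rfl⟩
    · simp [changesFrom]
    · rw [List.append_assoc, List.singleton_append, changesFrom_append_cons a b s [a]]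
      simp only [changesFrom]
      split <;> omega

theorem runCount_eq_cyclicChanges {w : Word} {a : Letter} (h₁ : w.head? = some a)
    (h₂ : w.getLast? = some a.swap) : runCount w = cyclicChanges w := by
  cases w with
  | nil => simp at h₁
  | cons b t =>
    obtain rfl : b = a := by simpa using h₁
    rw [runCount_cons]
    rcases List.eq_nil_or_concat' t with rfl | ⟨s, c, rfl⟩
    · simp only [List.getLast?_singleton, Option.some.injEq] at h₂
      exact absurd h₂.symm b.swap_ne
    · obtain rfl : c = b.swap := by
        rw [← List.cons_append, List.getLast?_append] at h₂
        simpa using h₂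
      simp only [cyclicChanges]
      rw [List.append_assoc, List.singleton_append, changesFrom_append_cons b _ s [b]]
      simp only [changesFrom, if_neg b.swap_ne]
      omega

theorem exists_replicate_append_of_mem {c : Letter} {s : Word} (h : c.swap ∈ s) :
    ∃ k rest, s = List.replicate k c ++ c.swap :: rest := by
  induction s with
  | nil => simp at h
  | cons b s ih =>
    by_cases hb : c = b
    · subst hb
      obtain ⟨k, rest, rfl⟩ := ih (by
        rcases List.mem_cons.1 h with h | h
        · exact absurd h c.swap_ne
        · exact h)
      exact ⟨k + 1, rest, by simp [List.replicate_succ]⟩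
    · exact ⟨0, s, by simp [Letter.eq_swap_of_ne hb]⟩

/-- A word in which both letters occur can be rotated so that its first and last letters
differ. -/
theorem exists_rotation_head_ne_getLast {w : Word} (hL : Letter.L ∈ w) (hR : Letter.R ∈ w) :
    ∃ u v a, w = u ++ v ∧ (v ++ u).head? = some a ∧ (v ++ u).getLast? = some a.swap := by
  cases w with
  | nil => simp at hL
  | cons c s =>
    have hc : c.swap ∈ s := by
      cases c
      · simpa [Letter.swap] using hR
      · simpa [Letter.swap] using hL
    obtain ⟨k, rest, rfl⟩ := exists_replicate_append_of_mem hc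
    refine ⟨List.replicate (k + 1) c, c.swap :: rest, c.swap, by simp [List.replicate_succ],
      by simp, ?_⟩
    rw [List.replicate_succ', ← List.append_assoc, List.getLast?_append]
    simp

theorem cyclicRunCount_eq_cyclicChanges {w : Word} (hL : Letter.L ∈ w) (hR : Letter.R ∈ w) :
    cyclicRunCount w = cyclicChanges w := by
  obtain ⟨u, v, a, rfl, h₁, h₂⟩ := exists_rotation_head_ne_getLast hL hR
  refine le_antisymm (Nat.sInf_le ⟨v ++ u, List.isRotated_append, ?_⟩) ?_
  · rw [runCount_eq_cyclicChanges h₁ h₂]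
    exact cyclicChanges_eq_of_isRotated List.isRotated_append
  · refine le_csInf ⟨_, _, List.IsRotated.refl _, rfl⟩ ?_
    rintro _ ⟨w', hw', rfl⟩
    exact (cyclicChanges_eq_of_isRotated hw').le.trans (cyclicChanges_le_runCount w')

theorem flatten_runs (V : Word) : (runs V).flatten = V := List.flatten_splitBy _ _

/-- Every run is a nonempty block of equal letters. -/
theorem exists_eq_replicate_of_mem_runs {V r : Word} (h : r ∈ runs V) :
    ∃ a k, r = List.replicate (k + 1) a := by
  have h₁ : r ≠ [] := List.ne_nil_of_mem_splitBy h
  have h₂ := List.isChain_of_mem_splitBy h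
  obtain ⟨a, t, rfl⟩ := List.exists_cons_of_ne_nil h₁
  refine ⟨a, t.length, ?_⟩
  clear h h₁
  rw [List.replicate_succ]
  congr 1
  induction t with
  | nil => rfl
  | cons b t ih =>
    rw [List.isChain_cons_cons] at h₂
    obtain rfl : a = b := by simpa using h₂.1
    rw [List.length_cons, List.replicate_succ, ← ih h₂.2]

theorem resizeRun_replicate (n k : ℕ) (a : Letter) :
    resizeRun n (List.replicate (k + 1) a) = List.replicate (4 * n + (k + 1) % n) a := by
  simp [List.replicate_succ, resizeRun]

theorem kappa_append (n : ℕ) {U V : Word}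
    (h : ∀ x ∈ U.getLast?, ∀ y ∈ V.head?, x ≠ y) :
    kappa n (U ++ V) = kappa n U ++ kappa n V := by
  unfold kappa runs
  rw [List.splitBy_append (by simpa using h)]
  simp

theorem runs_replicate (a : Letter) (k : ℕ) :
    runs (List.replicate (k + 1) a) = [List.replicate (k + 1) a] := by
  refine List.splitBy_of_isChain (by simp) ?_
  exact List.isChain_replicate_of_rel _ (by simp)

theorem kappa_replicate (n k : ℕ) (a : Letter) :
    kappa n (List.replicate (k + 1) a) = List.replicate (4 * n + (k + 1) % n) a := by
  simp [kappa, runs_replicate, resizeRun_replicate]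

theorem runs_assocWord (V : Word) : runs (assocWord V) = (runs V).map assocWord := by
  have key : ∀ (l : Word) (a : Letter) (g : Word) (gs : List Word),
      List.splitBy.loop (fun x y : Letter => decide (x = y)) (assocWord l) a.swap (assocWord g)
        (gs.map assocWord)
      = (List.splitBy.loop (fun x y : Letter => decide (x = y)) l a g gs).map assocWord := by
    intro l
    induction l with
    | nil => intro a g gs; simp [List.splitBy.loop, assocWord]
    | cons b l ih =>
      intro a g gs
      by_cases h : a = b
      · subst h
        simpa [List.splitBy.loop] using ih a (a :: g) gs
      · have h' : a.swap ≠ b.swap := fun e => h (by simpa using congrArg Letter.swap e)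
        have := ih b [] ((a :: g).reverse :: gs)
        simp [List.splitBy.loop, h, h', assocWord] at this ⊢
        simpa using this
  cases V with
  | nil => rfl
  | cons a t => exact key t a [] []

theorem kappa_assocWord (n : ℕ) (V : Word) :
    kappa n (assocWord V) = assocWord (kappa n V) := by
  have h : ∀ r, resizeRun n (assocWord r) = assocWord (resizeRun n r) := by
    intro r
    cases r with
    | nil => rfl
    | cons a r => simp [resizeRun, assocWord]
  simp only [kappa, runs_assocWord, List.map_map]
  rw [assocWord, List.map_flatten, List.map_map]
  congr 1
  exact List.map_congr_left fun r _ => h r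

/-! ### Words as matrices and row-balanced remainders -/

@[simp] theorem wordMat_nil : wordMat [] = 1 := rfl

@[simp] theorem wordMat_cons (a : Letter) (V : Word) :
    wordMat (a :: V) = a.toMat * wordMat V := by simp [wordMat]

theorem wordMat_append (U V : Word) : wordMat (U ++ V) = wordMat U * wordMat V := by
  simp [wordMat]

section Entries

variable (A : Mat) (j : Fin 2)

@[simp] theorem L_mul_zero : (Letter.L.toMat * A) 0 j = A 0 j := by
  simp [Letter.toMat, Matrix.mul_apply, Fin.sum_univ_two]

@[simp] theorem L_mul_one : (Letter.L.toMat * A) 1 j = A 0 j + A 1 j := by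
  simp [Letter.toMat, Matrix.mul_apply, Fin.sum_univ_two]

@[simp] theorem R_mul_zero : (Letter.R.toMat * A) 0 j = A 0 j + A 1 j := by
  simp [Letter.toMat, Matrix.mul_apply, Fin.sum_univ_two]

@[simp] theorem R_mul_one : (Letter.R.toMat * A) 1 j = A 1 j := by
  simp [Letter.toMat, Matrix.mul_apply, Fin.sum_univ_two]

@[simp] theorem mul_L_zero : (A * Letter.L.toMat) j 0 = A j 0 + A j 1 := by
  simp [Letter.toMat, Matrix.mul_apply, Fin.sum_univ_two]

@[simp] theorem mul_L_one : (A * Letter.L.toMat) j 1 = A j 1 := by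
  simp [Letter.toMat, Matrix.mul_apply, Fin.sum_univ_two]

@[simp] theorem mul_R_zero : (A * Letter.R.toMat) j 0 = A j 0 := by
  simp [Letter.toMat, Matrix.mul_apply, Fin.sum_univ_two]

@[simp] theorem mul_R_one : (A * Letter.R.toMat) j 1 = A j 0 + A j 1 := by
  simp [Letter.toMat, Matrix.mul_apply, Fin.sum_univ_two]

end Entries

theorem mat_ext {R : Type*} {A B : Matrix (Fin 2) (Fin 2) R} (h₀₀ : A 0 0 = B 0 0)
    (h₀₁ : A 0 1 = B 0 1) (h₁₀ : A 1 0 = B 1 0) (h₁₁ : A 1 1 = B 1 1) : A = B := by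
  ext i j
  fin_cases i <;> fin_cases j <;> assumption

/-- The two inequalities that define row-balanced matrices: no letter can be split off on the
left. -/
def RowBalanced (A : Mat) : Prop := A 1 0 < A 0 0 ∧ A 0 1 < A 1 1

theorem rowBalanced_one : RowBalanced 1 := by simp [RowBalanced]

theorem not_rowBalanced_letter_mul (x : Letter) (A : Mat) : ¬ RowBalanced (x.toMat * A) := by
  cases x <;> simp [RowBalanced]

theorem not_rowBalanced_wordMat_mul {W : Word} (hW : W ≠ []) (A : Mat) :
    ¬ RowBalanced (wordMat W * A) := by
  cases W with
  | nil => exact absurd rfl hW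
  | cons x W =>
    rw [wordMat_cons, Matrix.mul_assoc]
    exact not_rowBalanced_letter_mul x _

theorem letter_mul_left_cancel {x : Letter} {A B : Mat} (h : x.toMat * A = x.toMat * B) :
    A = B := by
  have e := fun i j => congrFun (congrFun h i) j
  cases x
  · have h₀ := e 0 0; have h₁ := e 0 1; have h₂ := e 1 0; have h₃ := e 1 1
    simp only [L_mul_zero, L_mul_one] at h₀ h₁ h₂ h₃
    apply mat_ext <;> omega
  · have h₀ := e 0 0; have h₁ := e 0 1; have h₂ := e 1 0; have h₃ := e 1 1
    simp only [R_mul_zero, R_mul_one] at h₀ h₁ h₂ h₃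
    apply mat_ext <;> omega

theorem letter_mul_right_cancel {x : Letter} {A B : Mat} (h : A * x.toMat = B * x.toMat) :
    A = B := by
  have e := fun i j => congrFun (congrFun h i) j
  cases x
  · have h₀ := e 0 0; have h₁ := e 0 1; have h₂ := e 1 0; have h₃ := e 1 1
    simp only [mul_L_zero, mul_L_one] at h₀ h₁ h₂ h₃
    apply mat_ext <;> omega
  · have h₀ := e 0 0; have h₁ := e 0 1; have h₂ := e 1 0; have h₃ := e 1 1
    simp only [mul_R_zero, mul_R_one] at h₀ h₁ h₂ h₃
    apply mat_ext <;> omega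

theorem wordMat_mul_diag_pos (W : Word) {N : Mat} (h₀ : 0 < N 0 0) (h₁ : 0 < N 1 1) :
    0 < (wordMat W * N) 0 0 ∧ 0 < (wordMat W * N) 1 1 := by
  induction W with
  | nil => simpa using ⟨h₀, h₁⟩
  | cons x W ih =>
    rw [wordMat_cons, Matrix.mul_assoc]
    cases x
    · simp only [L_mul_zero, L_mul_one]; omega
    · simp only [R_mul_zero, R_mul_one]; omega

/-- Splitting letters off a nonnegative matrix of positive determinant on the left, as long as
possible, leaves a row-balanced remainder. -/
theorem exists_wordMat_mul_rowBalanced {A : Mat} (hA : A 0 1 * A 1 0 < A 0 0 * A 1 1) :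
    ∃ W N, A = wordMat W * N ∧ RowBalanced N := by
  induction hs : A 0 0 + A 0 1 + A 1 0 + A 1 1 using Nat.strong_induction_on generalizing A with
  | _ s ih =>
    by_cases hrb : RowBalanced A
    · exact ⟨[], A, by simp, hrb⟩
    have h₀ : 0 < A 0 0 := by
      by_contra h; rw [Nat.eq_zero_of_not_pos h] at hA; simp at hA
    have h₁ : 0 < A 1 1 := by
      by_contra h; rw [Nat.eq_zero_of_not_pos h] at hA; simp at hA
    by_cases hc : A 0 0 ≤ A 1 0
    · have hd : A 0 1 ≤ A 1 1 := by
        by_contra hd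
        push Not at hd
        have := Nat.mul_le_mul hd.le hc
        nlinarith
      obtain ⟨W, N, hWN, hN⟩ := ih _ (by
          simp only [Matrix.of_apply, Matrix.cons_val', Matrix.cons_val_zero,
            Matrix.cons_val_one, Matrix.cons_val_fin_one]
          omega)
        (A := !![A 0 0, A 0 1; A 1 0 - A 0 0, A 1 1 - A 0 1]) (by
          obtain ⟨u, hu⟩ := Nat.exists_eq_add_of_le hc
          obtain ⟨v, hv⟩ := Nat.exists_eq_add_of_le hd
          rw [hu, hv] at hA
          simp [hu, hv]
          nlinarith) rfl
      refine ⟨Letter.L :: W, N, ?_, hN⟩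
      rw [wordMat_cons, Matrix.mul_assoc, ← hWN]
      apply mat_ext <;> simp <;> omega
    · have hd : A 1 1 ≤ A 0 1 := by
        by_contra hd
        exact hrb ⟨by omega, by omega⟩
      obtain ⟨W, N, hWN, hN⟩ := ih _ (by
          simp only [Matrix.of_apply, Matrix.cons_val', Matrix.cons_val_zero,
            Matrix.cons_val_one, Matrix.cons_val_fin_one]
          omega)
        (A := !![A 0 0 - A 1 0, A 0 1 - A 1 1; A 1 0, A 1 1]) (by
          push Not at hc
          obtain ⟨u, hu⟩ := Nat.exists_eq_add_of_le hc.le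
          obtain ⟨v, hv⟩ := Nat.exists_eq_add_of_le hd
          rw [hu, hv] at hA
          simp [hu, hv]
          nlinarith) rfl
      refine ⟨Letter.R :: W, N, ?_, hN⟩
      rw [wordMat_cons, Matrix.mul_assoc, ← hWN]
      apply mat_ext <;> simp <;> omega

theorem letter_eq_of_mul_eq {x y : Letter} {A B : Mat} (hA : 0 < A 0 0 ∧ 0 < A 1 1)
    (hB : 0 < B 0 0 ∧ 0 < B 1 1) (h : x.toMat * A = y.toMat * B) : x = y := by
  have e := fun i j => congrFun (congrFun h i) j
  have h₀ := e 0 0; have h₁ := e 0 1; have h₂ := e 1 0; have h₃ := e 1 1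
  cases x <;> cases y
  · rfl
  · simp only [L_mul_zero, L_mul_one, R_mul_zero, R_mul_one] at h₀ h₁ h₂ h₃
    omega
  · simp only [L_mul_zero, L_mul_one, R_mul_zero, R_mul_one] at h₀ h₁ h₂ h₃
    omega
  · rfl

theorem RowBalanced.diag_pos {N : Mat} (h : RowBalanced N) : 0 < N 0 0 ∧ 0 < N 1 1 :=
  ⟨(Nat.zero_le _).trans_lt h.1, (Nat.zero_le _).trans_lt h.2⟩

/-- The decomposition into a word and a row-balanced remainder is unique. -/
theorem wordMat_mul_rowBalanced_unique {W W' : Word} {N N' : Mat} (hN : RowBalanced N)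
    (hN' : RowBalanced N') (h : wordMat W * N = wordMat W' * N') : W = W' ∧ N = N' := by
  induction W generalizing W' with
  | nil =>
    cases W' with
    | nil => simpa using h
    | cons y W' =>
      rw [wordMat_nil, Matrix.one_mul] at h
      exact absurd (h ▸ hN) (not_rowBalanced_wordMat_mul (by simp) N')
  | cons x W ih =>
    cases W' with
    | nil =>
      rw [wordMat_nil, Matrix.one_mul] at h
      exact absurd (h ▸ hN') (not_rowBalanced_wordMat_mul (by simp) N)
    | cons y W' =>
      rw [wordMat_cons, wordMat_cons, Matrix.mul_assoc, Matrix.mul_assoc] at h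
      obtain rfl := letter_eq_of_mul_eq
        (wordMat_mul_diag_pos W hN.diag_pos.1 hN.diag_pos.2)
        (wordMat_mul_diag_pos W' hN'.diag_pos.1 hN'.diag_pos.2) h
      obtain ⟨rfl, rfl⟩ := ih (letter_mul_left_cancel h)
      exact ⟨rfl, rfl⟩

theorem wordMat_injective : Function.Injective wordMat := fun U V h =>
  (wordMat_mul_rowBalanced_unique rowBalanced_one rowBalanced_one
    (by rw [Matrix.mul_one, Matrix.mul_one, h])).1

theorem wordMat_diag_pos (V : Word) : 0 < wordMat V 0 0 ∧ 0 < wordMat V 1 1 := by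
  simpa using wordMat_mul_diag_pos V (N := 1) (by simp) (by simp)

theorem wordMat_offDiag_pos {V : Word} :
    (Letter.L ∈ V → 0 < wordMat V 1 0) ∧ (Letter.R ∈ V → 0 < wordMat V 0 1) := by
  induction V with
  | nil => simp
  | cons x V ih =>
    have := wordMat_diag_pos V
    rw [wordMat_cons]
    cases x
    · simp only [L_mul_zero, L_mul_one]
      refine ⟨fun _ => by omega, fun h => ih.2 (by simpa using h)⟩
    · simp only [R_mul_zero, R_mul_one]
      refine ⟨fun h => ih.1 (by simpa using h), fun _ => by omega⟩

/-- A nonnegative matrix of determinant one is the matrix of a word. -/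
theorem exists_eq_wordMat {A : Mat} (hA : A 0 0 * A 1 1 = 1 + A 0 1 * A 1 0) :
    ∃ W, A = wordMat W := by
  obtain ⟨W, N, hWN, hN⟩ := exists_wordMat_mul_rowBalanced (A := A) (by omega)
  refine ⟨W, ?_⟩
  have key : ∀ (W : Word), (wordMat W * N) 0 0 * (wordMat W * N) 1 1
      = 1 + (wordMat W * N) 0 1 * (wordMat W * N) 1 0 →
      N 0 0 * N 1 1 = 1 + N 0 1 * N 1 0 := by
    intro W
    induction W with
    | nil => simp
    | cons x W ih =>
      intro h
      apply ih
      rw [wordMat_cons, Matrix.mul_assoc] at h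
      cases x
      · simp only [L_mul_zero, L_mul_one] at h; linarith
      · simp only [R_mul_zero, R_mul_one] at h; linarith
  have hdet := key W (hWN ▸ hA)
  obtain ⟨h₁, h₂⟩ := hN
  obtain ⟨u, hu⟩ := Nat.exists_eq_add_of_lt h₁
  obtain ⟨v, hv⟩ := Nat.exists_eq_add_of_lt h₂
  rw [hu, hv] at hdet
  have h₃ : N 1 0 = 0 := by nlinarith
  have h₄ : N 0 1 = 0 := by nlinarith
  have h₅ : u = 0 := by nlinarith
  have h₆ : v = 0 := by nlinarith
  have : N = 1 := by apply mat_ext <;> simp <;> omega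
  rw [hWN, this, Matrix.mul_one]

theorem eq_replicate_of_swap_notMem {V : Word} {x : Letter} (h : x.swap ∉ V) :
    V = List.replicate V.length x := by
  refine List.eq_replicate_of_mem fun b hb => ?_
  by_contra hne
  exact h (Letter.eq_swap_of_ne (Ne.symm hne) ▸ hb)

theorem wordMat_replicate_L (k : ℕ) :
    wordMat (List.replicate k Letter.L) = !![1, 0; k, 1] := by
  induction k with
  | zero => apply mat_ext <;> simp
  | succ k ih =>
    rw [List.replicate_succ, wordMat_cons, ih]
    apply mat_ext <;> simp [add_comm]

theorem wordMat_replicate_R (k : ℕ) :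
    wordMat (List.replicate k Letter.R) = !![1, k; 0, 1] := by
  induction k with
  | zero => apply mat_ext <;> simp
  | succ k ih =>
    rw [List.replicate_succ, wordMat_cons, ih]
    apply mat_ext <;> simp [add_comm]

theorem wordMat_det (V : Word) :
    wordMat V 0 0 * wordMat V 1 1 = 1 + wordMat V 0 1 * wordMat V 1 0 := by
  induction V with
  | nil => simp
  | cons x V ih =>
    rw [wordMat_cons]
    cases x
    · simp only [L_mul_zero, L_mul_one]; linarith
    · simp only [R_mul_zero, R_mul_one]; linarith

/-- The trace detects the words in which both letters occur. -/
theorem two_lt_trace_wordMat_iff (V : Word) :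
    2 < wordMat V 0 0 + wordMat V 1 1 ↔ Letter.L ∈ V ∧ Letter.R ∈ V := by
  constructor
  · intro h
    constructor
    · by_contra hL
      rw [eq_replicate_of_swap_notMem (x := Letter.R) hL, wordMat_replicate_R] at h
      simp at h
    · by_contra hR
      rw [eq_replicate_of_swap_notMem (x := Letter.L) hR, wordMat_replicate_L] at h
      simp at h
  · rintro ⟨hL, hR⟩
    have h₁ := wordMat_diag_pos V
    have h₂ := wordMat_det V
    have h₃ : 0 < wordMat V 0 1 * wordMat V 1 0 :=
      Nat.mul_pos (wordMat_offDiag_pos.2 hR) (wordMat_offDiag_pos.1 hL)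
    by_contra h
    have h₄ : wordMat V 0 0 = 1 := by omega
    have h₅ : wordMat V 1 1 = 1 := by omega
    rw [h₄, h₅] at h₂
    omega

/-! ### Integer matrices -/

/-- `2 × 2` integer matrices. -/
abbrev ZMat : Type := Matrix (Fin 2) (Fin 2) ℤ

/-- A matrix with nonnegative integer entries, seen over the integers. -/
def toInt (M : Mat) : ZMat := M.map (Nat.cast : ℕ → ℤ)

@[simp] theorem toInt_apply (M : Mat) (i j : Fin 2) : toInt M i j = (M i j : ℤ) := rfl

theorem toInt_mul (M N : Mat) : toInt (M * N) = toInt M * toInt N :=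
  Matrix.map_mul (f := Nat.castRingHom ℤ)

@[simp] theorem toInt_one : toInt 1 = 1 := by apply mat_ext <;> simp

theorem toInt_injective : Function.Injective toInt := fun M N h => by
  ext i j
  have := congrFun (congrFun h i) j
  simpa using this

/-- The integer matrix of a word. -/
def wordInt (V : Word) : ZMat := toInt (wordMat V)

@[simp] theorem wordInt_nil : wordInt [] = 1 := toInt_one

theorem wordInt_append (U V : Word) : wordInt (U ++ V) = wordInt U * wordInt V := by
  simp [wordInt, wordMat_append, toInt_mul]

theorem wordInt_cons (x : Letter) (V : Word) : wordInt (x :: V) = wordInt [x] * wordInt V :=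
  wordInt_append [x] V

theorem wordInt_injective : Function.Injective wordInt := toInt_injective.comp wordMat_injective

@[simp] theorem wordInt_L : wordInt [Letter.L] = !![1, 0; 1, 1] := by
  apply mat_ext <;> simp [wordInt, Letter.toMat]

@[simp] theorem wordInt_R : wordInt [Letter.R] = !![1, 1; 0, 1] := by
  apply mat_ext <;> simp [wordInt, Letter.toMat]

theorem wordInt_det (V : Word) : (wordInt V).det = 1 := by
  have := congrArg (Nat.cast : ℕ → ℤ) (wordMat_det V)
  push_cast at this
  rw [Matrix.det_fin_two]
  simp only [wordInt, toInt_apply]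
  linarith

/-- A nonnegative integer matrix of determinant one is the matrix of a word. -/
theorem exists_eq_wordInt {A : ZMat} (hdet : A.det = 1) (hA : ∀ i j, 0 ≤ A i j) :
    ∃ W, A = wordInt W := by
  rw [Matrix.det_fin_two] at hdet
  obtain ⟨W, hW⟩ := exists_eq_wordMat (A := A.map Int.toNat) (by
    zify
    simp only [Matrix.map_apply, Int.toNat_of_nonneg (hA _ _)]
    linarith)
  refine ⟨W, ?_⟩
  rw [wordInt, ← hW]
  ext i j
  simp [Int.toNat_of_nonneg (hA i j)]

theorem two_lt_trace_wordInt_iff (V : Word) :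
    2 < (wordInt V).trace ↔ Letter.L ∈ V ∧ Letter.R ∈ V := by
  rw [← two_lt_trace_wordMat_iff, Matrix.trace_fin_two]
  simp only [wordInt, toInt_apply]
  norm_cast

/-- An integer matrix is primitive if no nonunit divides all its entries. -/
def IsPrimitive (K : ZMat) : Prop := ∀ (k : ℤ) (K' : ZMat), K = k • K' → IsUnit k

theorem IsPrimitive.mul_left {A K : ZMat} (hA : A.det = 1) (hK : IsPrimitive K) :
    IsPrimitive (A * K) := by
  intro k K' h
  refine hK k (A.adjugate * K') ?_
  rw [← Matrix.mul_smul, ← h, ← Matrix.mul_assoc, Matrix.adjugate_mul, hA, one_smul,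
    Matrix.one_mul]

theorem IsPrimitive.mul_right {A K : ZMat} (hA : A.det = 1) (hK : IsPrimitive K) :
    IsPrimitive (K * A) := by
  intro k K' h
  refine hK k (K' * A.adjugate) ?_
  rw [← Matrix.smul_mul, ← h, Matrix.mul_assoc, Matrix.mul_adjugate, hA, one_smul,
    Matrix.mul_one]

theorem isD_iff (n : ℕ) (M : Mat) : IsD n M ↔ (toInt M).det = n ∧ IsPrimitive (toInt M) := by
  refine and_congr Iff.rfl ⟨fun h k K' hk => ?_, fun h => ?_⟩
  · have hdvd : ∀ i j, k.natAbs ∣ M i j := fun i j => by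
      have := congrFun (congrFun hk i) j
      simp only [toInt_apply, Matrix.smul_apply, smul_eq_mul] at this
      exact Int.natAbs_dvd_natAbs.2 ⟨_, this⟩
    have := Nat.dvd_gcd (Nat.dvd_gcd (hdvd 0 0) (hdvd 0 1)) (Nat.dvd_gcd (hdvd 1 0) (hdvd 1 1))
    rw [h, Nat.dvd_one] at this
    exact Int.isUnit_iff_natAbs_eq.2 this
  · set g := Nat.gcd (Nat.gcd (M 0 0) (M 0 1)) (Nat.gcd (M 1 0) (M 1 1)) with hg
    have h₀ : g ∣ Nat.gcd (M 0 0) (M 0 1) := Nat.gcd_dvd_left _ _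
    have h₁ : g ∣ Nat.gcd (M 1 0) (M 1 1) := Nat.gcd_dvd_right _ _
    have hdvd : ∀ i j, ((g : ℕ) : ℤ) ∣ (M i j : ℤ) := by
      intro i j
      rw [Int.natCast_dvd_natCast]
      fin_cases i <;> fin_cases j
      · exact h₀.trans (Nat.gcd_dvd_left _ _)
      · exact h₀.trans (Nat.gcd_dvd_right _ _)
      · exact h₁.trans (Nat.gcd_dvd_left _ _)
      · exact h₁.trans (Nat.gcd_dvd_right _ _)
    choose f hf using hdvd
    have := h g f (by ext i j; exact hf i j)
    simpa using Int.isUnit_iff_natAbs_eq.1 this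

/-! ### Walks of the transducer -/

theorem IsD.mul_wordMat {n : ℕ} {M : Mat} (h : IsD n M) (V : Word) : IsD n (M * wordMat V) := by
  rw [isD_iff] at h ⊢
  rw [toInt_mul, Matrix.det_mul]
  have hV := wordInt_det V
  exact ⟨by rw [h.1]; exact (congrArg _ hV).trans (mul_one _), h.2.mul_right hV⟩

theorem isD_wordMat_mul_iff {n : ℕ} {M : Mat} {W : Word} :
    IsD n (wordMat W * M) ↔ IsD n M := by
  have hW : (toInt (wordMat W)).det = 1 := wordInt_det W
  rw [isD_iff, isD_iff, toInt_mul, Matrix.det_mul, hW, one_mul]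
  refine and_congr_right fun _ => ⟨fun h => ?_, fun h => h.mul_left hW⟩
  have hadj : (toInt (wordMat W)).adjugate.det = 1 := by
    rw [Matrix.det_adjugate, hW]; simp
  have := h.mul_left hadj
  rwa [← Matrix.mul_assoc, Matrix.adjugate_mul, hW, one_smul, Matrix.one_mul] at this

theorem IsD.det_pos {n : ℕ} (hn : 0 < n) {M : Mat} (h : IsD n M) :
    M 0 1 * M 1 0 < M 0 0 * M 1 1 := by
  have := h.1
  rw [Matrix.det_fin_two] at this
  simp only [Matrix.map_apply] at this
  zify
  have : (0 : ℤ) < n := by exact_mod_cast hn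
  linarith

theorem IsD.exists_wordMat_mul {n : ℕ} (hn : 0 < n) {M : Mat} (h : IsD n M) :
    ∃ W N, M = wordMat W * N ∧ IsRB n N := by
  obtain ⟨W, N, hWN, hN⟩ := exists_wordMat_mul_rowBalanced (h.det_pos hn)
  exact ⟨W, N, hWN, isD_wordMat_mul_iff.1 (hWN ▸ h), hN⟩

/-- If a letter makes a row-balanced matrix lose its balance, the remainder left after splitting
off the output is column-balanced as well. -/
theorem columnBalanced_of_exit {A N : Mat} {x : Letter} {W : Word} (hA : RowBalanced A)
    (hN : RowBalanced N) (hW : W ≠ []) (h : A * x.toMat = wordMat W * N) :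
    N 0 1 < N 0 0 ∧ N 1 0 < N 1 1 := by
  obtain ⟨hN₁, hN₂⟩ := hN
  obtain ⟨hA₁, hA₂⟩ := hA
  -- If the letter `x` could be split off on the right of `N`, it would cancel, and `A` would
  -- have `W` as a left factor.
  have cancel : ∀ N' : Mat, N = N' * x.toMat → False := by
    rintro N' rfl
    rw [← Matrix.mul_assoc] at h
    exact not_rowBalanced_wordMat_mul hW N' (letter_mul_right_cancel h ▸ ⟨hA₁, hA₂⟩)
  have mono : ∀ (W : Word) (j k : Fin 2), (∀ i, N i j ≤ N i k) →
      ∀ i, (wordMat W * N) i j ≤ (wordMat W * N) i k := fun W j k hjk i => by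
    simp only [Matrix.mul_apply]
    exact Finset.sum_le_sum fun l _ => Nat.mul_le_mul_left _ (hjk l)
  cases x
  · constructor
    · by_contra hc
      have := mono W 0 1 (by rw [Fin.forall_fin_two]; omega) 0
      rw [← h] at this
      simp only [mul_L_zero, mul_L_one] at this
      omega
    · by_contra hc
      refine cancel !![N 0 0 - N 0 1, N 0 1; N 1 0 - N 1 1, N 1 1] ?_
      apply mat_ext <;> simp <;> omega
  · constructor
    · by_contra hc
      refine cancel !![N 0 0, N 0 1 - N 0 0; N 1 0, N 1 1 - N 1 0] ?_
      apply mat_ext <;> simp <;> omega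
    · by_contra hc
      have := mono W 1 0 (by rw [Fin.forall_fin_two]; omega) 1
      rw [← h] at this
      simp only [mul_R_zero, mul_R_one] at this
      omega

theorem not_columnBalanced_mul_letter (A : Mat) (x : Letter) :
    ¬ ((A * x.toMat) 0 1 < (A * x.toMat) 0 0 ∧ (A * x.toMat) 1 0 < (A * x.toMat) 1 1) := by
  cases x <;> simp

/-- A row-balanced matrix that reads a word and loses its balance does so after a well-defined
shortest prefix; the remainder is then a state of the transducer. -/
theorem exists_first_exit {n : ℕ} (hn : 0 < n) {M : Mat} {V : Word} (hM : IsRB n M)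
    (hV : ¬ IsRB n (M * wordMat V)) :
    ∃ P Q W N, V = P ++ Q ∧ P ≠ [] ∧ M * wordMat P = wordMat W * N ∧ IsDB n N ∧
      ¬ IsRB n (M * wordMat P) ∧
      ∀ V₁ : Word, V₁ <+: P → V₁ ≠ P → IsRB n (M * wordMat V₁) := by
  induction V using List.reverseRecOn with
  | nil => simp [hM] at hV
  | append_singleton V x ih =>
    by_cases h : IsRB n (M * wordMat V)
    · obtain ⟨W, N, hWN, hN⟩ := (hM.1.mul_wordMat (V ++ [x])).exists_wordMat_mul hn
      have hW : W ≠ [] := by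
        rintro rfl
        rw [wordMat_nil, Matrix.one_mul] at hWN
        exact hV (hWN ▸ hN)
      refine ⟨V ++ [x], [], W, N, by simp, by simp, hWN, ⟨hN, hN.1, ?_⟩, hV, ?_⟩
      · refine columnBalanced_of_exit h.2 hN.2 hW (x := x) ?_
        rw [← hWN, wordMat_append, Matrix.mul_assoc]
        simp
      · by_contra hex
        push Not at hex
        obtain ⟨V₁, h₁, h₂, h₃⟩ := hex
        -- A counterexample is a proper prefix of `V ++ [x]`, hence a prefix of `V`; reading the
        -- rest of `V` cannot restore the row balance.
        rw [List.prefix_concat_iff] at h₁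
        obtain ⟨Z, rfl⟩ := h₁.resolve_left h₂
        obtain ⟨W₁, N₁, hWN₁, hN₁⟩ := (hM.1.mul_wordMat V₁).exists_wordMat_mul hn
        have hW₁ : W₁ ≠ [] := by
          rintro rfl
          rw [wordMat_nil, Matrix.one_mul] at hWN₁
          exact h₃ (hWN₁ ▸ hN₁)
        rw [wordMat_append, ← Matrix.mul_assoc, hWN₁, Matrix.mul_assoc] at h
        exact not_rowBalanced_wordMat_mul hW₁ _ h.2
    · obtain ⟨P, Q, W, N, rfl, h₂⟩ := ih h
      exact ⟨P, Q ++ [x], W, N, by simp, h₂⟩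

theorem inputWord_cons (e : Transition) (C : List Transition) :
    inputWord (e :: C) = e.input ++ inputWord C := by simp [inputWord]

theorem outputWord_cons (e : Transition) (C : List Transition) :
    outputWord (e :: C) = e.output ++ outputWord C := by simp [outputWord]

theorem inputWord_append (C D : List Transition) :
    inputWord (C ++ D) = inputWord C ++ inputWord D := by simp [inputWord]

theorem outputWord_append (C D : List Transition) :
    outputWord (C ++ D) = outputWord C ++ outputWord D := by simp [outputWord]

theorem IsWalk.mul_eq {n : ℕ} {M N : Mat} {C : List Transition} (h : IsWalk n M C N) :
    M * wordMat (inputWord C) = wordMat (outputWord C) * N := by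
  induction h with
  | nil M hM => simp [inputWord, outputWord]
  | cons e C N he hC ih =>
    rw [inputWord_cons, outputWord_cons, wordMat_append, wordMat_append, ← Matrix.mul_assoc,
      he.2.2.1, Matrix.mul_assoc, ih, Matrix.mul_assoc]

theorem IsWalk.isDB_left {n : ℕ} {M N : Mat} {C : List Transition} (h : IsWalk n M C N) :
    IsDB n M := by
  cases h with
  | nil _ hM => exact hM
  | cons e C _ he hC => exact he.1

theorem IsWalk.append {n : ℕ} {M N O : Mat} {C D : List Transition} (h : IsWalk n M C N)
    (h' : IsWalk n N D O) : IsWalk n M (C ++ D) O := by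
  induction h with
  | nil => exact h'
  | cons e C N he _ ih => exact .cons e _ _ he (ih h')

/-- Walks are exactly the matrix identities `M V = W N` between states. -/
theorem exists_walk {n : ℕ} (hn : 0 < n) {M N : Mat} {V W : Word} (hM : IsDB n M)
    (hN : IsDB n N) (h : M * wordMat V = wordMat W * N) :
    ∃ C, IsWalk n M C N ∧ inputWord C = V ∧ outputWord C = W := by
  induction hl : V.length using Nat.strong_induction_on generalizing M V W with
  | _ l ih =>
    by_cases hV : IsRB n (M * wordMat V)
    · obtain ⟨rfl, hNV⟩ := wordMat_mul_rowBalanced_unique hN.1.2 hV.2 (W' := [])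
        (by rw [← h]; simp)
      rcases List.eq_nil_or_concat' V with rfl | ⟨V, x, rfl⟩
      · simp only [wordMat_nil, Matrix.mul_one] at hNV
        subst hNV
        exact ⟨[], .nil _ hM, rfl, rfl⟩
      · refine absurd hN.2.2 ?_
        rw [hNV, wordMat_append, ← Matrix.mul_assoc]
        simpa using not_columnBalanced_mul_letter (M * wordMat V) x
    · obtain ⟨P, Q, W₁, N₁, rfl, hP, h₁, hN₁, hexit, hpre⟩ := exists_first_exit hn hM.1 hV
      obtain ⟨W₂, N₂, h₂, hN₂⟩ := (hN₁.1.1.mul_wordMat Q).exists_wordMat_mul hn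
      obtain ⟨rfl, rfl⟩ := wordMat_mul_rowBalanced_unique hN.1.2 hN₂.2 (W' := W₁ ++ W₂) (by
        rw [← h, wordMat_append, ← Matrix.mul_assoc, h₁, Matrix.mul_assoc, h₂, wordMat_append,
          Matrix.mul_assoc])
      obtain ⟨C, hC, rfl, rfl⟩ := ih Q.length (by
        rw [← hl, List.length_append]
        have := List.length_pos_iff.2 hP
        omega) hN₁ h₂ rfl
      exact ⟨⟨M, P, W₁, N₁⟩ :: C, .cons ⟨M, P, W₁, N₁⟩ C N ⟨hM, hN₁, h₁, hexit, hpre⟩ hC,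
        inputWord_cons _ _, outputWord_cons _ _⟩

theorem IsTransition.eq_of_prefix {n : ℕ} {e e' : Transition} (he : IsTransition n e)
    (he' : IsTransition n e') (hsrc : e.src = e'.src) {V : Word} (h : e.input <+: V)
    (h' : e'.input <+: V) : e = e' := by
  obtain ⟨src, inp, out, tgt⟩ := e
  obtain ⟨src', inp', out', tgt'⟩ := e'
  obtain ⟨_, hN, heq, hexit, hpre⟩ := he
  obtain ⟨_, hN', heq', hexit', hpre'⟩ := he'
  dsimp only at *
  subst hsrc
  obtain rfl : inp = inp' := by
    by_contra hne
    rcases List.prefix_or_prefix_of_prefix h h' with hp | hp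
    · exact hexit (hpre' _ hp hne)
    · exact hexit' (hpre _ hp (Ne.symm hne))
  obtain ⟨rfl, rfl⟩ := wordMat_mul_rowBalanced_unique hN.1.2 hN'.1.2 (heq ▸ heq')
  rfl

theorem IsTransition.input_ne_nil {n : ℕ} {e : Transition} (he : IsTransition n e) :
    e.input ≠ [] := fun h => he.2.2.2.1 (by simpa [h] using he.1.1)

/-- A walk is determined by its first state and its input word. -/
theorem IsWalk.eq_of_inputWord_eq {n : ℕ} {M N N' : Mat} {C C' : List Transition}
    (h : IsWalk n M C N) (h' : IsWalk n M C' N') (heq : inputWord C = inputWord C') :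
    C = C' := by
  induction h generalizing C' with
  | nil M hM =>
    cases h' with
    | nil => rfl
    | cons e C' _ he hC' =>
      rw [inputWord_cons] at heq
      exact absurd (List.append_eq_nil_iff.1 heq.symm).1 he.input_ne_nil
  | cons e C N he hC ih =>
    generalize hM : e.src = M' at h'
    cases h' with
    | nil =>
      rw [inputWord_cons] at heq
      exact absurd (List.append_eq_nil_iff.1 heq).1 he.input_ne_nil
    | cons e' C' _ he' hC' =>
      rw [inputWord_cons, inputWord_cons] at heq
      obtain rfl := he.eq_of_prefix he' hM (List.prefix_append _ _)
        (by rw [heq]; exact List.prefix_append _ _)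
      rw [ih hC' (List.append_cancel_left heq)]

theorem wordPow_succ {α : Type*} (V : List α) (m : ℕ) :
    wordPow V (m + 1) = V ++ wordPow V m := by simp [wordPow, List.replicate_succ]

@[simp] theorem wordPow_zero {α : Type*} (V : List α) : wordPow V 0 = [] := rfl

theorem IsWalk.wordPow {n : ℕ} {M : Mat} {C : List Transition} (h : IsWalk n M C M) (m : ℕ) :
    IsWalk n M (wordPow C m) M := by
  induction m with
  | zero => exact .nil M h.isDB_left
  | succ m ih => rw [wordPow_succ]; exact h.append ih

theorem inputWord_wordPow (C : List Transition) (m : ℕ) :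
    inputWord (wordPow C m) = wordPow (inputWord C) m := by
  induction m with
  | zero => rfl
  | succ m ih => rw [wordPow_succ, wordPow_succ, inputWord_append, ih]

theorem outputWord_wordPow (C : List Transition) (m : ℕ) :
    outputWord (wordPow C m) = wordPow (outputWord C) m := by
  induction m with
  | zero => rfl
  | succ m ih => rw [wordPow_succ, wordPow_succ, outputWord_append, ih]

/-! ### Conjugating words -/

section Entries

variable (K : ZMat) (i : Fin 2)

theorem mul_wordInt_L_zero : (K * wordInt [Letter.L]) i 0 = K i 0 + K i 1 := by
  simp [Matrix.mul_apply, Fin.sum_univ_two]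

theorem mul_wordInt_L_one : (K * wordInt [Letter.L]) i 1 = K i 1 := by
  simp [Matrix.mul_apply, Fin.sum_univ_two]

theorem mul_wordInt_R_zero : (K * wordInt [Letter.R]) i 0 = K i 0 := by
  simp [Matrix.mul_apply, Fin.sum_univ_two]

theorem mul_wordInt_R_one : (K * wordInt [Letter.R]) i 1 = K i 0 + K i 1 := by
  simp [Matrix.mul_apply, Fin.sum_univ_two]

end Entries

/-- The `i`-th row of `K` does not contain entries of opposite signs. -/
def RowInCone (K : ZMat) (i : Fin 2) : Prop :=
  (0 ≤ K i 0 ∧ 0 ≤ K i 1) ∨ (K i 0 ≤ 0 ∧ K i 1 ≤ 0)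

theorem RowInCone.mul_toInt {K : ZMat} {i : Fin 2} (h : RowInCone K i) (P : Mat) :
    RowInCone (K * toInt P) i := by
  have e : ∀ j, (K * toInt P) i j = K i 0 * P 0 j + K i 1 * P 1 j := fun j => by
    simp [Matrix.mul_apply, Fin.sum_univ_two]
  unfold RowInCone
  rw [e, e]
  refine h.imp (fun ⟨h₀, h₁⟩ => ⟨by positivity, by positivity⟩) (fun ⟨h₀, h₁⟩ => ?_)
  have := fun (a : ℕ) => mul_nonpos_of_nonpos_of_nonneg h₀ (Int.natCast_nonneg a)
  have := fun (a : ℕ) => mul_nonpos_of_nonpos_of_nonneg h₁ (Int.natCast_nonneg a)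
  constructor <;> apply add_nonpos <;> apply_assumption

/-- As long as a row keeps entries of opposite signs, each letter makes the sum of the absolute
values of its entries smaller. -/
theorem abs_mul_letter_lt {K : ZMat} {i : Fin 2} {x : Letter}
    (h : ¬ RowInCone (K * wordInt [x]) i) :
    |(K * wordInt [x]) i 0| + |(K * wordInt [x]) i 1| < |K i 0| + |K i 1| := by
  unfold RowInCone at h
  cases x
  · rw [mul_wordInt_L_zero, mul_wordInt_L_one] at *
    cases abs_cases (K i 0) <;> cases abs_cases (K i 1) <;>
      cases abs_cases (K i 0 + K i 1) <;> omega
  · rw [mul_wordInt_R_zero, mul_wordInt_R_one] at *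
    cases abs_cases (K i 0) <;> cases abs_cases (K i 1) <;>
      cases abs_cases (K i 0 + K i 1) <;> omega

theorem abs_mul_wordInt_le {K : ZMat} {i : Fin 2} {V : Word}
    (h : ¬ RowInCone (K * wordInt V) i) :
    |(K * wordInt V) i 0| + |(K * wordInt V) i 1| + V.length ≤ |K i 0| + |K i 1| := by
  induction V generalizing K with
  | nil => simp
  | cons x V ih =>
    rw [wordInt_cons, ← Matrix.mul_assoc] at h ⊢
    have h₁ := ih h
    have h₂ : ¬ RowInCone (K * wordInt [x]) i := fun hc => h (hc.mul_toInt _)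
    have h₃ := abs_mul_letter_lt h₂
    rw [List.length_cons]
    push_cast
    linarith

theorem wordInt_wordPow (V : Word) (m : ℕ) : wordInt (wordPow V m) = wordInt V ^ m := by
  induction m with
  | zero => simp
  | succ m ih => rw [wordPow_succ, wordInt_append, ih, pow_succ']

theorem length_wordPow {α : Type*} (V : List α) (m : ℕ) :
    (wordPow V m).length = m * V.length := by simp [wordPow]

theorem exists_rowInCone_mul_pow (K : ZMat) {V : Word} (hV : V ≠ []) :
    ∃ m, ∀ i, RowInCone (K * wordInt V ^ m) i := by
  set b := max (|K 0 0| + |K 0 1|) (|K 1 0| + |K 1 1|)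
  refine ⟨b.toNat + 1, fun i => ?_⟩
  by_contra h
  rw [← wordInt_wordPow] at h
  have h₁ := abs_mul_wordInt_le h
  rw [length_wordPow] at h₁
  have h₂ : |K i 0| + |K i 1| ≤ b := by
    revert i
    rw [Fin.forall_fin_two]
    exact ⟨fun _ _ => le_max_left _ _, fun _ _ => le_max_right _ _⟩
  have h₃ : 0 < V.length := List.length_pos_iff.2 hV
  have h₄ : ((b.toNat + 1 : ℕ) : ℤ) ≤ ((b.toNat + 1) * V.length : ℕ) := by
    exact_mod_cast Nat.le_mul_of_pos_right _ h₃
  have h₅ := Int.self_le_toNat b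
  have h₆ := abs_nonneg ((K * wordInt (wordPow V (b.toNat + 1))) i 0)
  have h₇ := abs_nonneg ((K * wordInt (wordPow V (b.toNat + 1))) i 1)
  push_cast at h₄ h₁
  linarith

theorem wordInt_pos {V : Word} (hL : Letter.L ∈ V) (hR : Letter.R ∈ V) (i j : Fin 2) :
    0 < wordInt V i j := by
  have h₁ := wordMat_diag_pos V
  have h₂ := wordMat_offDiag_pos.1 hL
  have h₃ := wordMat_offDiag_pos.2 hR
  simp only [wordInt, toInt_apply, Nat.cast_pos]
  fin_cases i <;> fin_cases j <;> simp [h₁, h₂, h₃]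

theorem transpose_wordInt (V : Word) :
    (wordInt V).transpose = wordInt (assocWord V.reverse) := by
  induction V with
  | nil => simp
  | cons x V ih =>
    rw [wordInt_cons, Matrix.transpose_mul, ih, List.reverse_cons, assocWord_append,
      wordInt_append]
    congr 1
    cases x <;> apply mat_ext <;> simp [Letter.swap]

theorem mul_pow_eq {K A B : ZMat} (h : K * A = B * K) (m : ℕ) : K * A ^ m = B ^ m * K :=
  ((show SemiconjBy K A B from h).pow_right m).eq

/-- If a nonsingular integer matrix `K` intertwines two words in which both letters occur, then
`K V ^ m` is nonnegative or nonpositive for large `m`: the powers of `V` draw the rows of `K`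
into the cones of constant sign, those of `W` do so with the columns, and the signs of the rows
and of the columns have to agree. This is the contraction to the Perron eigenvectors. -/
theorem exists_mul_pow_nonneg {K : ZMat} (hK : K.det ≠ 0) {V W : Word} (hVL : Letter.L ∈ V)
    (hVR : Letter.R ∈ V) (hW : W ≠ []) (h : K * wordInt V = wordInt W * K) :
    ∃ m, (∀ i j, 0 ≤ (K * wordInt V ^ m) i j) ∨ (∀ i j, (K * wordInt V ^ m) i j ≤ 0) := by
  obtain ⟨m₁, h₁⟩ := exists_rowInCone_mul_pow K (List.ne_nil_of_mem hVL)
  obtain ⟨m₂, h₂⟩ := exists_rowInCone_mul_pow K.transpose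
    (V := assocWord W.reverse) (by simpa [assocWord] using hW)
  refine ⟨m₁ + m₂ + 1, ?_⟩
  set X := K * wordInt V ^ (m₁ + m₂ + 1) with hX
  have hcol : ∀ j, RowInCone X.transpose j := fun j => by
    have e : X.transpose = K.transpose * wordInt (assocWord W.reverse) ^ m₂ *
        toInt (wordMat (wordPow (assocWord W.reverse) (m₁ + 1))) := by
      change _ = _ * wordInt _
      rw [wordInt_wordPow, Matrix.mul_assoc, ← pow_add, hX, mul_pow_eq h,
        ← transpose_wordInt, ← Matrix.transpose_pow, ← Matrix.transpose_mul]
      congr 3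
      omega
    rw [e]
    exact (h₂ j).mul_toInt _
  -- The rows of `Y` have constant sign, and multiplication by the positive matrix `V` makes
  -- the rows of `X` strictly positive or strictly negative.
  set Y := K * wordInt V ^ m₁ * wordInt (wordPow V m₂) with hY
  have hrow : ∀ i, RowInCone Y i := fun i => (h₁ i).mul_toInt _
  have hXY : X = Y * wordInt V := by
    rw [hX, hY, wordInt_wordPow, Matrix.mul_assoc, Matrix.mul_assoc, ← pow_succ, ← pow_add,
      add_assoc]
  have hYdet : Y.det ≠ 0 := by
    rw [hY, Matrix.det_mul, Matrix.det_mul, Matrix.det_pow, wordInt_det, wordInt_det]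
    simpa using hK
  have hstrict : ∀ i, (0 < X i 0 ∧ 0 < X i 1) ∨ (X i 0 < 0 ∧ X i 1 < 0) := fun i => by
    have e : ∀ j, X i j = Y i 0 * wordInt V 0 j + Y i 1 * wordInt V 1 j := fun j => by
      rw [hXY]
      simp [Matrix.mul_apply, Fin.sum_univ_two]
    have hne : Y i 0 ≠ 0 ∨ Y i 1 ≠ 0 := by
      by_contra hc
      push Not at hc
      apply hYdet
      rw [Matrix.det_fin_two]
      revert i
      rw [Fin.forall_fin_two]
      constructor
      · intro _ hc
        simp [hc.1, hc.2]
      · intro _ hc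
        simp [hc.1, hc.2]
    have hp := wordInt_pos hVL hVR
    rw [e, e]
    rcases hrow i with ⟨a, b⟩ | ⟨a, b⟩
    · left
      rcases hne with hne | hne
      · have := lt_of_le_of_ne a hne.symm
        constructor <;> apply add_pos_of_pos_of_nonneg <;> first
          | exact mul_pos this (hp _ _)
          | exact mul_nonneg b (hp _ _).le
      · have := lt_of_le_of_ne b hne.symm
        constructor <;> apply add_pos_of_nonneg_of_pos <;> first
          | exact mul_pos this (hp _ _)
          | exact mul_nonneg a (hp _ _).le
    · right
      rcases hne with hne | hne
      · have := lt_of_le_of_ne a hne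
        constructor <;> apply add_neg_of_neg_of_nonpos <;> first
          | exact mul_neg_of_neg_of_pos this (hp _ _)
          | exact mul_nonpos_of_nonpos_of_nonneg b (hp _ _).le
      · have := lt_of_le_of_ne b hne
        constructor <;> apply add_neg_of_nonpos_of_neg <;> first
          | exact mul_neg_of_neg_of_pos this (hp _ _)
          | exact mul_nonpos_of_nonpos_of_nonneg a (hp _ _).le
  have s₀ := hstrict 0
  have s₁ := hstrict 1
  have c₀ := hcol 0
  simp only [RowInCone, Matrix.transpose_apply] at c₀
  rcases s₀ with s₀ | s₀
  · left
    have s₁ : 0 < X 1 0 ∧ 0 < X 1 1 := by omega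
    simp only [Fin.forall_fin_two]
    omega
  · right
    have s₁ : X 1 0 < 0 ∧ X 1 1 < 0 := by omega
    simp only [Fin.forall_fin_two]
    omega

/-- Two words conjugated by a word are rotations of each other. -/
theorem isRotated_of_append_eq_append {U V W : Word} (h : U ++ V = W ++ U) : V ~r W := by
  induction hl : U.length using Nat.strong_induction_on generalizing U with
  | _ l ih =>
    rcases List.append_eq_append_iff.1 h with ⟨Z, rfl, rfl⟩ | ⟨Z, rfl, hZ⟩
    · exact List.isRotated_append
    · by_cases hW : W = []
      · subst hW
        have : V = [] := by simpa using h
        rw [this]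
      · refine ih Z.length ?_ hZ.symm rfl
        rw [← hl, List.length_append]
        have := List.length_pos_iff.2 hW
        omega

/-- Two words in which both letters occur are rotations of each other if their matrices are
conjugate in `SL₂(ℤ)`. -/
theorem isRotated_of_conj {K : ZMat} (hK : K.det = 1) {V W : Word} (hVL : Letter.L ∈ V)
    (hVR : Letter.R ∈ V) (hW : W ≠ []) (h : K * wordInt V = wordInt W * K) : V ~r W := by
  obtain ⟨m, hm⟩ := exists_mul_pow_nonneg (by rw [hK]; exact one_ne_zero) hVL hVR hW h
  set X := K * wordInt V ^ m with hX
  have hXdet : X.det = 1 := by rw [hX, Matrix.det_mul, Matrix.det_pow, wordInt_det, hK]; simp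
  have hXV : X * wordInt V = wordInt W * X := by
    rw [hX, Matrix.mul_assoc, ← pow_succ, pow_succ', ← Matrix.mul_assoc, h, Matrix.mul_assoc]
  have key : ∀ Y : ZMat, Y.det = 1 → (∀ i j, 0 ≤ Y i j) → Y * wordInt V = wordInt W * Y →
      V ~r W := by
    intro Y hdet hY hYV
    obtain ⟨U, rfl⟩ := exists_eq_wordInt hdet hY
    rw [← wordInt_append, ← wordInt_append] at hYV
    exact isRotated_of_append_eq_append (wordInt_injective hYV)
  rcases hm with hm | hm
  · exact key X hXdet hm hXV
  · refine key (-X) ?_ (fun i j => by simpa using hm i j) (by simp [hXV])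
    rw [Matrix.det_neg, hXdet]
    simp

/-! ### Left equivalence and output words -/

/-- Two integer matrices are left equivalent if they lie in the same coset of `SL₂(ℤ)`. -/
def LeftEquiv (K K' : ZMat) : Prop := ∃ A : ZMat, A.det = 1 ∧ K = A * K'

theorem LeftEquiv.refl (K : ZMat) : LeftEquiv K K := ⟨1, by simp, by simp⟩

theorem det_adjugate_eq_one {A : ZMat} (hA : A.det = 1) : A.adjugate.det = 1 := by
  rw [Matrix.det_adjugate, hA]; simp

theorem adjugate_mul_cancel {A : ZMat} (hA : A.det = 1) (K : ZMat) : A.adjugate * (A * K) = K := by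
  rw [← Matrix.mul_assoc, Matrix.adjugate_mul, hA, one_smul, Matrix.one_mul]

theorem mul_adjugate_cancel {A : ZMat} (hA : A.det = 1) (K : ZMat) : K * A * A.adjugate = K := by
  rw [Matrix.mul_assoc, Matrix.mul_adjugate, hA, one_smul, Matrix.mul_one]

theorem LeftEquiv.symm {K K' : ZMat} (h : LeftEquiv K K') : LeftEquiv K' K := by
  obtain ⟨A, hA, rfl⟩ := h
  exact ⟨A.adjugate, det_adjugate_eq_one hA, (adjugate_mul_cancel hA K').symm⟩

theorem LeftEquiv.trans {K K' K'' : ZMat} (h : LeftEquiv K K') (h' : LeftEquiv K' K'') :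
    LeftEquiv K K'' := by
  obtain ⟨A, hA, rfl⟩ := h
  obtain ⟨B, hB, rfl⟩ := h'
  exact ⟨A * B, by rw [Matrix.det_mul, hA, hB, mul_one], (Matrix.mul_assoc ..).symm⟩

theorem LeftEquiv.mul_right {K K' : ZMat} (h : LeftEquiv K K') (X : ZMat) :
    LeftEquiv (K * X) (K' * X) := by
  obtain ⟨A, hA, rfl⟩ := h
  exact ⟨A, hA, Matrix.mul_assoc ..⟩

theorem LeftEquiv.of_mul_left {A : ZMat} (hA : A.det = 1) (K : ZMat) : LeftEquiv (A * K) K :=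
  ⟨A, hA, rfl⟩

theorem LeftEquiv.of_mul_right {K K' X : ZMat} (hX : X.det = 1)
    (h : LeftEquiv (K * X) (K' * X)) : LeftEquiv K K' := by
  have := h.mul_right X.adjugate
  rwa [mul_adjugate_cancel hX, mul_adjugate_cancel hX] at this

theorem LeftEquiv.neg (K : ZMat) : LeftEquiv (-K) K := ⟨-1, by simp [Matrix.det_neg], by simp⟩

theorem LeftEquiv.det_eq {K K' : ZMat} (h : LeftEquiv K K') : K.det = K'.det := by
  obtain ⟨A, hA, rfl⟩ := h
  rw [Matrix.det_mul, hA, one_mul]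

theorem LeftEquiv.isPrimitive {K K' : ZMat} (h : LeftEquiv K K') (hK : IsPrimitive K') :
    IsPrimitive K := by
  obtain ⟨A, hA, rfl⟩ := h
  exact hK.mul_left hA

/-- Some representative of the coset of `K` turns the input word `V` into the output word `W`,
that is, it satisfies `T V = W T`. -/
def HasOutput (K : ZMat) (V W : Word) : Prop :=
  ∃ T, LeftEquiv T K ∧ T * wordInt V = wordInt W * T

theorem HasOutput.rotate {K : ZMat} {U V W : Word} :
    HasOutput K (U ++ V) W ↔ HasOutput (K * wordInt U) (V ++ U) W := by
  constructor
  · rintro ⟨T, hT, h⟩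
    refine ⟨T * wordInt U, hT.mul_right _, ?_⟩
    rw [wordInt_append] at h ⊢
    rw [← Matrix.mul_assoc (wordInt W), ← h]
    simp only [Matrix.mul_assoc]
  · rintro ⟨T, hT, h⟩
    have hU := wordInt_det U
    refine ⟨T * (wordInt U).adjugate, ?_, ?_⟩
    · have := hT.mul_right (wordInt U).adjugate
      rwa [mul_adjugate_cancel hU] at this
    · rw [wordInt_append] at h ⊢
      rw [← mul_adjugate_cancel hU (wordInt V), Matrix.mul_assoc T,
        adjugate_mul_cancel hU, ← Matrix.mul_assoc, h, Matrix.mul_assoc]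

/-- Exchanging both the rows and the columns of an integer matrix. -/
def flip (K : ZMat) : ZMat := !![K 1 1, K 1 0; K 0 1, K 0 0]

@[simp] theorem flip_flip (K : ZMat) : flip (flip K) = K := by apply mat_ext <;> simp [flip]

theorem flip_mul (K K' : ZMat) : flip (K * K') = flip K * flip K' := by
  apply mat_ext <;> simp [flip, Matrix.mul_apply, Fin.sum_univ_two, add_comm]

theorem flip_det (K : ZMat) : (flip K).det = K.det := by
  rw [flip, Matrix.det_fin_two_of, Matrix.det_fin_two]
  ring

theorem LeftEquiv.flip {K K' : ZMat} (h : LeftEquiv K K') :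
    LeftEquiv (Raney.flip K) (Raney.flip K') := by
  obtain ⟨A, hA, rfl⟩ := h
  exact ⟨Raney.flip A, by rw [flip_det, hA], flip_mul _ _⟩

theorem wordInt_assocWord (V : Word) : wordInt (assocWord V) = flip (wordInt V) := by
  induction V with
  | nil => apply mat_ext <;> simp [flip]
  | cons x V ih =>
    rw [assocWord_cons, wordInt_cons, ih, wordInt_cons x, flip_mul]
    congr 1
    cases x <;> apply mat_ext <;> simp [Letter.swap, flip]

theorem HasOutput.flip {K : ZMat} {V W : Word} (h : HasOutput K V W) :
    HasOutput (Raney.flip K) (assocWord V) (assocWord W) := by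
  obtain ⟨T, hT, h⟩ := h
  refine ⟨Raney.flip T, hT.flip, ?_⟩
  rw [wordInt_assocWord, wordInt_assocWord, ← flip_mul, ← flip_mul, h]

/-! ### Changing the length of a run -/

theorem trace_eq_of_mul_eq {T A A' : ZMat} (hT : T.det ≠ 0) (h : T * A = A' * T) :
    A.trace = A'.trace := by
  have h₁ : (T * A * T.adjugate).trace = (A' * T * T.adjugate).trace := by rw [h]
  rw [Matrix.mul_assoc, Matrix.trace_mul_comm, Matrix.mul_assoc, Matrix.adjugate_mul,
    Matrix.mul_assoc, Matrix.mul_adjugate, Matrix.mul_smul, Matrix.mul_smul, Matrix.trace_smul,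
    Matrix.trace_smul, Matrix.mul_one, Matrix.mul_one] at h₁
  exact mul_left_cancel₀ hT h₁

/-- The lower unitriangular matrices; they are the powers of `L`, also with negative
exponents. -/
def shear (x : ℤ) : ZMat := !![1, 0; x, 1]

theorem shear_det (x : ℤ) : (shear x).det = 1 := by simp [shear, Matrix.det_fin_two]

theorem shear_add (x y : ℤ) : shear (x + y) = shear x * shear y := by
  apply mat_ext <;> simp [shear]

theorem shear_zero : shear 0 = 1 := by apply mat_ext <;> simp [shear]

theorem wordInt_replicate_L (k : ℕ) : wordInt (List.replicate k Letter.L) = shear k := by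
  rw [wordInt, wordMat_replicate_L]
  apply mat_ext <;> simp [shear]

/-- The rotation `R L⁻¹ R = L⁻¹ R L⁻¹` by a right angle. -/
def quarterTurn : ZMat := !![0, 1; -1, 0]

/-- The product of the quarter turn and a word `Z` is conjugate to a word with no more cyclic
changes than `R Z R`, provided that its trace exceeds two: distinct first and last letters of
`Z` cancel against the quarter turn, a pair `L … L` becomes a single `R`, and in the remaining
cases the trace is too small. -/
theorem exists_conj_quarterTurn_mul (Z : Word) (h : 2 < (quarterTurn * wordInt Z).trace) :
    ∃ U B, Matrix.det B = 1 ∧ B * (quarterTurn * wordInt Z) = wordInt U * B ∧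
      cyclicChanges U ≤ cyclicChanges (Letter.R :: Z ++ [Letter.R]) := by
  induction hl : Z.length using Nat.strong_induction_on generalizing Z with
  | _ l ih =>
    have step : ∀ (x y : Letter) (Z' : Word) (Q : ZMat), Z = x :: Z' ++ [y] →
        wordInt [y] * quarterTurn * wordInt [x] = Q →
        wordInt [y] * (quarterTurn * wordInt Z) = Q * wordInt Z' * wordInt [y] := by
      rintro x y Z' Q rfl rfl
      rw [wordInt_append, wordInt_cons x]
      simp only [Matrix.mul_assoc]
    have cancel : ∀ (x y : Letter) (Z' : Word), Z = x :: Z' ++ [y] →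
        wordInt [y] * quarterTurn * wordInt [x] = quarterTurn →
        ∃ U B, Matrix.det B = 1 ∧ B * (quarterTurn * wordInt Z) = wordInt U * B ∧
          cyclicChanges U ≤ cyclicChanges (Letter.R :: Z ++ [Letter.R]) := by
      intro x y Z' hZ hQ
      have hs := step x y Z' _ hZ hQ
      have hy := wordInt_det [y]
      have ht := trace_eq_of_mul_eq (by rw [hy]; exact one_ne_zero) hs
      obtain ⟨U, B, hB, hU, hle⟩ := ih Z'.length (by rw [← hl, hZ]; simp) Z'
        (by rwa [← ht]) rfl
      refine ⟨U, B * wordInt [y], by rw [Matrix.det_mul, hB, hy, one_mul], ?_, hle.trans ?_⟩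
      · rw [Matrix.mul_assoc, hs, ← Matrix.mul_assoc, hU, Matrix.mul_assoc]
      · refine cyclicChanges_le_of_sublist ?_
        rw [hZ]
        refine List.Sublist.append ?_ (List.Sublist.refl _)
        refine List.Sublist.cons_cons _ ((List.sublist_append_left Z' [y]).trans ?_)
        exact List.sublist_cons_self _ _
    cases Z with
    | nil => simp [quarterTurn, Matrix.trace_fin_two] at h
    | cons x Z =>
      rcases List.eq_nil_or_concat' Z with rfl | ⟨Z', y, rfl⟩
      · cases x <;> simp [quarterTurn, Matrix.trace_fin_two] at h
      cases x <;> cases y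
      · have hs := step Letter.L Letter.L Z' (wordInt [Letter.R]) rfl
          (by apply mat_ext <;> simp [quarterTurn])
        rw [← wordInt_cons] at hs
        refine ⟨Letter.R :: Z', _, wordInt_det _, hs, cyclicChanges_le_of_sublist ?_⟩
        refine List.Sublist.cons_cons _ ?_
        refine (List.sublist_append_left Z' [Letter.L]).trans ?_
        exact (List.sublist_cons_self _ _).trans (List.sublist_append_left _ _)
      · exact cancel _ _ Z' rfl (by apply mat_ext <;> simp [quarterTurn])
      · exact cancel _ _ Z' rfl (by apply mat_ext <;> simp [quarterTurn])
      · exfalso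
        have hs := step Letter.R Letter.R Z' (-wordInt [Letter.L]) rfl
          (by apply mat_ext <;> simp [quarterTurn])
        have ht := trace_eq_of_mul_eq (by rw [wordInt_det]; exact one_ne_zero) hs
        rw [neg_mul, ← wordInt_cons, Matrix.trace_neg] at ht
        rw [ht, Matrix.trace_fin_two] at h
        simp only [wordInt, toInt_apply] at h
        omega

theorem exists_lowerTriangular {K : ZMat} (hK : 0 < K.det) :
    ∃ B : ZMat, B.det = 1 ∧ (B * K) 0 1 = 0 ∧ 0 < (B * K) 0 0 ∧ 0 < (B * K) 1 1 := by
  obtain ⟨u, v, huv⟩ : ∃ u v : ℤ, u * K 0 1 + v * K 1 1 = (Int.gcd (K 0 1) (K 1 1) : ℤ) :=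
    ⟨Int.gcdA (K 0 1) (K 1 1), Int.gcdB (K 0 1) (K 1 1), by rw [Int.gcd_eq_gcd_ab]; ring⟩
  have hg : 0 < (Int.gcd (K 0 1) (K 1 1) : ℤ) := by
    rw [Int.natCast_pos, Int.gcd_pos_iff]
    by_contra hc
    push Not at hc
    rw [Matrix.det_fin_two, hc.1, hc.2] at hK
    simp at hK
  obtain ⟨b, hb⟩ := Int.gcd_dvd_left (K 0 1) (K 1 1)
  obtain ⟨d, hd⟩ := Int.gcd_dvd_right (K 0 1) (K 1 1)
  set g : ℤ := (Int.gcd (K 0 1) (K 1 1) : ℤ)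
  have hdet : d * v + b * u = 1 := by
    apply mul_left_cancel₀ hg.ne'
    calc g * (d * v + b * u) = u * (g * b) + v * (g * d) := by ring
      _ = g * 1 := by rw [← hb, ← hd, huv, mul_one]
  have hB : Matrix.det !![d, -b; u, v] = 1 := by rw [Matrix.det_fin_two_of]; linarith
  have h₀ : (!![d, -b; u, v] * K) 0 1 = 0 := by
    simp only [Matrix.mul_apply, Fin.sum_univ_two]
    simp only [Matrix.of_apply, Matrix.cons_val', Matrix.cons_val_zero, Matrix.cons_val_one,
      Matrix.cons_val_fin_one]
    rw [hb, hd]; ring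
  have h₁ : (!![d, -b; u, v] * K) 1 1 = g := by
    simp only [Matrix.mul_apply, Fin.sum_univ_two]
    simpa using huv
  refine ⟨_, hB, h₀, ?_, by rw [h₁]; exact hg⟩
  have h₂ : (!![d, -b; u, v] * K).det = K.det := by rw [Matrix.det_mul, hB, one_mul]
  rw [Matrix.det_fin_two, h₀, h₁, zero_mul, sub_zero] at h₂
  rw [← h₂] at hK
  exact pos_of_mul_pos_left hK hg.le

/-- A representative `T` of the coset of `K` that is adapted to the block `L ^ i` at the
beginning of `V`: it is lower triangular, so `T L ^ n = L ^ e T` for some `e`, and the diagonal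
entry of `T V T⁻¹` is reduced modulo its upper right entry. -/
theorem HasOutput.exists_adapted {K : ZMat} (hK : 0 < K.det) {V W : Word} (hR : Letter.R ∈ V)
    (h : HasOutput K V W) :
    ∃ T A B : ZMat, LeftEquiv T K ∧ T 0 1 = 0 ∧ 0 < T 1 1 ∧ A.det = 1 ∧
      T * wordInt V = A * T ∧ B.det = 1 ∧ B * wordInt W = A * B ∧
      0 < A 0 0 ∧ A 0 0 ≤ A 0 1 := by
  obtain ⟨T₀, hT₀, h₀⟩ := h
  obtain ⟨B₀, hB₀, h₁, h₂, h₃⟩ := exists_lowerTriangular (K := T₀) (by rwa [hT₀.det_eq])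
  set T₁ := B₀ * T₀ with hT₁
  set A₁ := B₀ * wordInt W * B₀.adjugate with hA₁
  have hA₁T : T₁ * wordInt V = A₁ * T₁ := by
    rw [hA₁, hT₁, Matrix.mul_assoc, h₀, Matrix.mul_assoc _ B₀.adjugate,
      adjugate_mul_cancel hB₀, Matrix.mul_assoc]
  have hA₁B : B₀ * wordInt W = A₁ * B₀ := by
    rw [hA₁, Matrix.mul_assoc, Matrix.adjugate_mul, hB₀, one_smul, Matrix.mul_one]
  have hA₁det : A₁.det = 1 := by
    rw [hA₁, Matrix.det_mul, Matrix.det_mul, hB₀, wordInt_det, det_adjugate_eq_one hB₀]; rfl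
  have hq : 0 < A₁ 0 1 := by
    have e := congrFun (congrFun hA₁T 0) 1
    simp only [Matrix.mul_apply, Fin.sum_univ_two, h₁, zero_mul, mul_zero, add_zero,
      zero_add] at e
    have hV : 0 < wordInt V 0 1 := by
      simpa [wordInt] using wordMat_offDiag_pos.2 hR
    exact pos_of_mul_pos_left (e ▸ mul_pos h₂ hV) h₃.le
  have hT₁K : LeftEquiv T₁ K := (LeftEquiv.of_mul_left hB₀ _).trans hT₀
  clear_value A₁ T₁
  set x := (A₁ 0 0 - 1) / A₁ 0 1 with hx
  have hx₁ := Int.emod_add_mul_ediv (A₁ 0 0 - 1) (A₁ 0 1)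
  have hx₂ := Int.emod_nonneg (A₁ 0 0 - 1) hq.ne'
  have hx₃ := Int.emod_lt_of_pos (A₁ 0 0 - 1) hq
  rw [← hx] at hx₁
  have hs : ∀ X : ZMat, shear (-x) * (shear x * X) = X := fun X => by
    rw [← Matrix.mul_assoc, ← shear_add, neg_add_cancel, shear_zero, Matrix.one_mul]
  have e₀ : (shear x * A₁ * shear (-x)) 0 0 = A₁ 0 0 - A₁ 0 1 * x := by
    simp only [Matrix.mul_apply, Fin.sum_univ_two]
    simp [shear, sub_eq_add_neg]
  have e₁ : (shear x * A₁ * shear (-x)) 0 1 = A₁ 0 1 := by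
    simp only [Matrix.mul_apply, Fin.sum_univ_two]
    simp [shear]
  refine ⟨shear x * T₁, shear x * A₁ * shear (-x), shear x * B₀,
    ?_, ?_, ?_, ?_, ?_, ?_, ?_, ?_, ?_⟩
  · exact (LeftEquiv.of_mul_left (shear_det x) _).trans hT₁K
  · simp [shear, Matrix.mul_apply, Fin.sum_univ_two, h₁]
  · simpa [shear, Matrix.mul_apply, Fin.sum_univ_two, h₁] using h₃
  · simp [Matrix.det_mul, shear_det, hA₁det]
  · rw [Matrix.mul_assoc, hA₁T, Matrix.mul_assoc _ (shear (-x)), hs, Matrix.mul_assoc]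
  · rw [Matrix.det_mul, shear_det, hB₀, one_mul]
  · rw [Matrix.mul_assoc, hA₁B, Matrix.mul_assoc _ (shear (-x)), hs, Matrix.mul_assoc]
  · rw [e₀]; linarith
  · rw [e₀, e₁]; linarith

/-- A nonnegative matrix with dominating upper right entry is the matrix of a word that begins
and ends with `R`. -/
theorem exists_eq_wordInt_R_R {p q r s : ℤ} (hdet : p * s - q * r = 1) (hp : 0 < p) (hpq : p ≤ q)
    (hs : 0 < s) (hsq : s ≤ q) :
    ∃ Z, !![p, q; r, s] = wordInt Z ∧ (Z = [Letter.R] ∨ ∃ Z', Z = Letter.R :: Z' ++ [Letter.R]) := by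
  have hq : 0 < q := hp.trans_le hpq
  have hr : 0 ≤ r := by
    by_contra hr
    nlinarith [mul_pos hp hs]
  have hrp : r < p := by
    by_contra hc
    nlinarith [mul_le_mul_of_nonneg_left hsq hp.le]
  have hrs : r < s := by
    by_contra hc
    nlinarith [mul_le_mul_of_nonneg_left hpq hs.le]
  obtain ⟨Z, hZ⟩ := exists_eq_wordInt (A := !![p, q; r, s])
    (by rw [Matrix.det_fin_two_of]; exact hdet) (by
      simp only [Fin.forall_fin_two]
      simp
      omega)
  refine ⟨Z, hZ, ?_⟩
  have e := fun i j => congrFun (congrFun hZ i) j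
  have e₀ := e 0 0; have e₁ := e 0 1; have e₂ := e 1 0; have e₃ := e 1 1
  simp only [wordInt, toInt_apply, Matrix.of_apply, Matrix.cons_val', Matrix.cons_val_zero,
    Matrix.cons_val_one, Matrix.cons_val_fin_one] at e₀ e₁ e₂ e₃
  cases Z with
  | nil => simp at e₁; omega
  | cons x Z =>
    cases x
    · rw [wordMat_cons] at e₀ e₁ e₂ e₃
      simp only [L_mul_zero, L_mul_one] at e₀ e₁ e₂ e₃
      omega
    · rcases List.eq_nil_or_concat' Z with rfl | ⟨Z', y, rfl⟩
      · exact Or.inl rfl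
      · cases y
        · rw [← List.cons_append, wordMat_append] at e₀ e₁ e₂ e₃
          have h₀ : ∀ A : Mat, A * wordMat [Letter.L] = A * Letter.L.toMat := fun A => by simp
          rw [h₀] at e₀ e₁ e₂ e₃
          simp only [mul_L_zero, mul_L_one] at e₀ e₁ e₂ e₃
          have := wordMat_diag_pos (Letter.R :: Z')
          omega
        · exact Or.inr ⟨Z', rfl⟩

/-- Changing the length of a block `L ^ i` of the input, within its class modulo `n`, to a
length of at least `4 * n` does not decrease the number of cyclic changes of the output.

In the notation of the proof the output is conjugate to `L ^ j A₀` with `A₀ = R … R`, where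
`j ≥ -1` since the trace exceeds two, and adding `n` to `i` adds a positive square to `j`. For
`j ≥ 1` the number of cyclic changes is that of `L A₀`, for `j ≤ 0` it is at most that of
`A₀`. -/
theorem HasOutput.resize_L {n : ℕ} (hn : 0 < n) {K : ZMat} (hK : K.det = n) {i i' : ℕ}
    {Y W : Word} (hi : 0 < i) (hR : Letter.R ∈ Y) (hii' : i ≡ i' [MOD n]) (hi' : 4 * n ≤ i')
    (h : HasOutput K (List.replicate i Letter.L ++ Y) W) :
    ∃ W', HasOutput K (List.replicate i' Letter.L ++ Y) W' ∧
      cyclicChanges W ≤ cyclicChanges W' := by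
  obtain ⟨T, A, B, hTK, hT₀₁, hT₁₁, hA, hTV, hB, hBW, hp, hpq⟩ := h.exists_adapted
    (by rw [hK]; exact_mod_cast hn) (by simp [hR])
  have hdT : T.det = n := by rw [hTK.det_eq, hK]
  have hdT₀ : T.det ≠ 0 := by rw [hdT]; exact_mod_cast hn.ne'
  have hTn : T 0 0 * T 1 1 = n := by
    rw [← hdT, Matrix.det_fin_two, hT₀₁]
    ring
  set q := A 0 1 with hq
  set p := A 0 0 with hp'
  have hq₀ : 0 < q := hp.trans_le hpq
  set j := (A 1 1 - 1) / q with hj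
  set s := A 1 1 - q * j with hs
  have hs₁ := Int.emod_add_mul_ediv (A 1 1 - 1) q
  have hs₂ := Int.emod_nonneg (A 1 1 - 1) hq₀.ne'
  have hs₃ := Int.emod_lt_of_pos (A 1 1 - 1) hq₀
  rw [← hj] at hs₁
  obtain ⟨Z, hZ, hZR⟩ := exists_eq_wordInt_R_R (p := p) (q := q) (r := A 1 0 - p * j) (s := s)
    (by rw [Matrix.det_fin_two] at hA; rw [hs]; linear_combination hA) hp hpq
    (by omega) (by omega)
  have hAZ : A = shear j * wordInt Z := by
    rw [← hZ]
    apply mat_ext <;> simp [shear, ← hp', ← hq, hs] <;> ring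
  -- Reading `L ^ n` in the state `T` outputs `L ^ (T 1 1 ^ 2)`.
  have hshift : ∀ (k : ℕ) (m : ℤ), (k : ℤ) = i + n * m →
      T * wordInt (List.replicate k Letter.L ++ Y) =
        shear (j + T 1 1 ^ 2 * m) * wordInt Z * T := by
    intro k m hk
    have h₁ : T * shear (n * m) = shear (T 1 1 ^ 2 * m) * T := by
      apply mat_ext <;> simp [shear, Matrix.mul_apply, Fin.sum_univ_two, hT₀₁]
      rw [← hTn]
      ring
    rw [add_comm j, shear_add, wordInt_append, wordInt_replicate_L, hk, add_comm, shear_add,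
      Matrix.mul_assoc (shear _) (shear j), ← hAZ, Matrix.mul_assoc (shear (T 1 1 ^ 2 * m)),
      ← hTV, wordInt_append, wordInt_replicate_L]
    simp only [← Matrix.mul_assoc]
    rw [h₁]
  have htrace : ∀ (k : ℕ) (m : ℤ), 0 < k → (k : ℤ) = i + n * m →
      2 < (shear (j + T 1 1 ^ 2 * m) * wordInt Z).trace := by
    intro k m hk₀ hk
    rw [← trace_eq_of_mul_eq hdT₀ (hshift k m hk), two_lt_trace_wordInt_iff]
    exact ⟨by simp [hk₀.ne'], by simp [hR]⟩
  have hbound : ∀ x : ℤ, 2 < (shear x * wordInt Z).trace → -1 ≤ x := by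
    intro x hx
    rw [← hZ, Matrix.trace_fin_two] at hx
    simp [shear] at hx
    by_contra hc
    have : x ≤ -2 := by omega
    nlinarith
  obtain ⟨m, hm⟩ := (Nat.modEq_iff_dvd.1 hii' : (n : ℤ) ∣ i' - i)
  have hj₁ : -1 ≤ j := hbound j (by simpa using htrace i 0 hi (by ring))
  have hj₂ : 1 ≤ j + T 1 1 ^ 2 * m := by
    -- The block of length `i' - 3 * n ≥ n` is still nonempty, and the last `3 * n` letters
    -- contribute `3 * T 1 1 ^ 2 ≥ 3` to the exponent.
    have h₁ := hbound _ (htrace (i' - 3 * n) (m - 3) (by omega) (by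
      rw [Nat.cast_sub (by omega)]; push_cast; linarith))
    have : 1 ≤ T 1 1 ^ 2 := by nlinarith
    linarith
  obtain ⟨j', hj'⟩ := Int.eq_ofNat_of_zero_le (by omega : 0 ≤ j + T 1 1 ^ 2 * m - 1)
  have hj'' : j + T 1 1 ^ 2 * m = ((j' + 1 : ℕ) : ℤ) := by push_cast; omega
  refine ⟨List.replicate (j' + 1) Letter.L ++ Z, ⟨T, hTK, ?_⟩, ?_⟩
  · rw [hshift i' m (by linarith), hj'', wordInt_append, wordInt_replicate_L]
  have hW : Letter.L ∈ W ∧ Letter.R ∈ W := by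
    rw [← two_lt_trace_wordInt_iff, trace_eq_of_mul_eq (by rw [hB]; exact one_ne_zero) hBW,
      ← trace_eq_of_mul_eq hdT₀ hTV, two_lt_trace_wordInt_iff]
    exact ⟨by simp [hi.ne'], by simp [hR]⟩
  have hWU : ∀ (U : Word) (D : ZMat), D.det = 1 → D * A = wordInt U * D →
      cyclicChanges W = cyclicChanges U := by
    intro U D hD hDU
    have h₁ : D * B * wordInt W = wordInt U * (D * B) := by
      rw [Matrix.mul_assoc, hBW, ← Matrix.mul_assoc, hDU, Matrix.mul_assoc]
    have h₂ : (D * B).det = 1 := by rw [Matrix.det_mul, hD, hB, one_mul]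
    refine cyclicChanges_eq_of_isRotated (isRotated_of_conj h₂ hW.1 hW.2 ?_ h₁)
    rintro rfl
    have h₃ := trace_eq_of_mul_eq (by rw [h₂]; exact one_ne_zero) h₁
    have h₄ := (two_lt_trace_wordInt_iff W).2 hW
    rw [h₃] at h₄
    simp at h₄
  have hsub : cyclicChanges Z ≤ cyclicChanges (List.replicate (j' + 1) Letter.L ++ Z) :=
    cyclicChanges_le_of_sublist (List.sublist_append_right _ _)
  -- For `j = -1`, conjugating `L⁻¹ R Z' R` by `R` gives the product of `R L⁻¹ R` and `Z'`.
  rcases (by omega : j = -1 ∨ 0 ≤ j) with hj₀ | hj₀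
  · have htA : 2 < A.trace := by
      rw [hAZ]
      simpa using htrace i 0 hi (by ring)
    rcases hZR with rfl | ⟨Z', rfl⟩
    · rw [hAZ, hj₀, Matrix.trace_fin_two] at htA
      simp [shear] at htA
    · have hRA : wordInt [Letter.R] * A = quarterTurn * wordInt Z' * wordInt [Letter.R] := by
        have : quarterTurn = wordInt [Letter.R] * shear (-1) * wordInt [Letter.R] := by
          apply mat_ext <;> simp [shear, quarterTurn]
        rw [hAZ, hj₀, this, wordInt_append, wordInt_cons _ Z']
        simp only [Matrix.mul_assoc]
      have hRdet := wordInt_det [Letter.R]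
      obtain ⟨U, D, hD, hDU, hle⟩ := exists_conj_quarterTurn_mul Z' (by
        rwa [← trace_eq_of_mul_eq (by rw [hRdet]; exact one_ne_zero) hRA])
      rw [hWU U (D * wordInt [Letter.R]) (by rw [Matrix.det_mul, hD, hRdet, one_mul]) (by
        rw [Matrix.mul_assoc, hRA, ← Matrix.mul_assoc, hDU, Matrix.mul_assoc])]
      exact hle.trans hsub
  · obtain ⟨k, hk⟩ := Int.eq_ofNat_of_zero_le hj₀
    rw [hWU (List.replicate k Letter.L ++ Z) 1 (by simp) (by
      rw [hAZ, hk, wordInt_append, wordInt_replicate_L, Matrix.one_mul, Matrix.mul_one])]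
    cases k with
    | zero => simpa using hsub
    | succ k => rw [cyclicChanges_replicate_append, cyclicChanges_replicate_append]

theorem assocWord_replicate (k : ℕ) (x : Letter) :
    assocWord (List.replicate k x) = List.replicate k x.swap := by simp [assocWord]

theorem HasOutput.resize {n : ℕ} (hn : 0 < n) {K : ZMat} (hK : K.det = n) {i i' : ℕ} {x : Letter}
    {X Y W : Word} (hi : 0 < i) (hx : x.swap ∈ X ++ Y) (hii' : i ≡ i' [MOD n]) (hi' : 4 * n ≤ i')
    (h : HasOutput K (X ++ List.replicate i x ++ Y) W) :
    ∃ W', HasOutput K (X ++ List.replicate i' x ++ Y) W' ∧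
      cyclicChanges W ≤ cyclicChanges W' := by
  rw [List.append_assoc, HasOutput.rotate, List.append_assoc] at h
  have hK' : (K * wordInt X).det = n := by rw [Matrix.det_mul, hK, wordInt_det, mul_one]
  have hx' : x.swap ∈ Y ++ X := by simpa [or_comm] using hx
  simp only [List.append_assoc X, HasOutput.rotate (U := X),
    List.append_assoc (List.replicate i' x)]
  cases x
  · exact h.resize_L hn hK' hi hx' hii' hi'
  · have h' := h.flip
    rw [assocWord_append, assocWord_replicate] at h'
    obtain ⟨W', hW', hle⟩ := h'.resize_L hn (by rw [flip_det, hK']) hi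
      (by simpa [assocWord] using List.mem_map_of_mem (f := Letter.swap) hx') hii' hi'
    refine ⟨assocWord W', ?_, ?_⟩
    · have := hW'.flip
      rw [flip_flip, assocWord_append, assocWord_replicate, assocWord_assocWord] at this
      exact this
    · rw [cyclicChanges_assocWord] at hle ⊢
      exact hle

theorem modEq_four_mul_add_mod (n k : ℕ) : k ≡ 4 * n + k % n [MOD n] := by
  simp [Nat.ModEq]

theorem mem_resizeRun {n k : ℕ} (hn : 0 < n) {x y : Letter}
    (h : y ∈ List.replicate (k + 1) x) : y ∈ resizeRun n (List.replicate (k + 1) x) := by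
  rw [resizeRun_replicate, List.eq_of_mem_replicate h]
  simp
  omega

/-- Resizing all the runs of the input does not decrease the number of cyclic changes of the
output. -/
theorem HasOutput.kappa {n : ℕ} (hn : 0 < n) {K : ZMat} (hK : K.det = n) {V W : Word}
    (hL : Letter.L ∈ V) (hR : Letter.R ∈ V) (h : HasOutput K V W) :
    ∃ W', HasOutput K (kappa n V) W' ∧ cyclicChanges W ≤ cyclicChanges W' := by
  have key : ∀ (rs : List Word) (X W : Word), (∀ r ∈ rs, ∃ a k, r = List.replicate (k + 1) a) →
      (∀ x, x ∈ X ++ rs.flatten) → HasOutput K (X ++ rs.flatten) W →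
      ∃ W', HasOutput K (X ++ (rs.map (resizeRun n)).flatten) W' ∧
        cyclicChanges W ≤ cyclicChanges W' := by
    intro rs
    induction rs with
    | nil => exact fun X W _ _ h => ⟨W, h, le_rfl⟩
    | cons r rs ih =>
      intro X W hrs hmem h
      obtain ⟨a, k, rfl⟩ := hrs r (by simp)
      rw [List.flatten_cons, ← List.append_assoc] at h hmem
      have ha : a.swap ∈ X ++ rs.flatten := by
        have := hmem a.swap
        simp only [List.mem_append, List.mem_replicate, a.swap_ne, and_false, or_false] at this
        simpa using this
      obtain ⟨W₁, h₁, hle₁⟩ := h.resize hn hK k.succ_pos ha (modEq_four_mul_add_mod n (k + 1))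
        (Nat.le_add_right _ _)
      rw [← resizeRun_replicate] at h₁
      obtain ⟨W₂, h₂, hle₂⟩ := ih (X ++ resizeRun n (List.replicate (k + 1) a)) W₁
        (fun r hr => hrs r (List.mem_cons_of_mem _ hr)) (fun x => by
          have := hmem x
          simp only [List.mem_append] at this ⊢
          exact this.imp_left (Or.imp_right (mem_resizeRun hn))) h₁
      exact ⟨W₂, by simpa using h₂, hle₁.trans hle₂⟩
  have := key (runs V) [] W (fun r hr => exists_eq_replicate_of_mem_runs hr)
    (by rw [flatten_runs]; rintro (_ | _) <;> assumption) (by rwa [flatten_runs])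
  exact this

/-- The resized word acts on the cosets of `SL₂(ℤ)` like the original one. -/
theorem leftEquiv_mul_kappa {n : ℕ} {K : ZMat} (hK : K.det = n) (V : Word) :
    LeftEquiv (K * wordInt (Raney.kappa n V)) (K * wordInt V) := by
  -- `K X K⁻¹` is integral whenever `X` is the identity modulo `n = det K`.
  have hpow : ∀ (K : ZMat) (k : ℕ) (m : ℤ), K.det = n → LeftEquiv (K * shear (k + n * m))
      (K * shear k) := by
    intro K k m hK
    refine ⟨!![1 + m * K 0 1 * K 1 1, - m * K 0 1 * K 0 1; m * K 1 1 * K 1 1,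
      1 - m * K 0 1 * K 1 1], by rw [Matrix.det_fin_two_of]; ring, ?_⟩
    rw [Matrix.det_fin_two] at hK
    apply mat_ext <;> simp [shear, Matrix.mul_apply, Fin.sum_univ_two]
    · linear_combination -(m * K 0 1) * hK
    · ring
    · linear_combination -(m * K 1 1) * hK
    · ring
  have hblock : ∀ (x : Letter) (K : ZMat) (k k' : ℕ), K.det = n → k ≡ k' [MOD n] →
      LeftEquiv (K * wordInt (List.replicate k' x)) (K * wordInt (List.replicate k x)) := by
    intro x K k k' hK hkk'
    obtain ⟨m, hm⟩ := (Nat.modEq_iff_dvd.1 hkk' : (n : ℤ) ∣ k' - k)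
    have hk' : (k' : ℤ) = k + n * m := by linarith
    cases x
    · rw [wordInt_replicate_L, wordInt_replicate_L, hk']
      exact hpow K k m hK
    · have h := (hpow (flip K) k m (by rw [flip_det, hK])).flip
      rw [flip_mul, flip_mul, flip_flip, ← hk', ← wordInt_replicate_L, ← wordInt_replicate_L,
        ← wordInt_assocWord, ← wordInt_assocWord, assocWord_replicate, assocWord_replicate] at h
      exact h
  have key : ∀ (rs : List Word) (K : ZMat), K.det = n →
      (∀ r ∈ rs, ∃ a k, r = List.replicate (k + 1) a) →
      LeftEquiv (K * wordInt (rs.map (resizeRun n)).flatten) (K * wordInt rs.flatten) := by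
    intro rs
    induction rs with
    | nil => exact fun K _ _ => LeftEquiv.refl _
    | cons r rs ih =>
      intro K hK hrs
      obtain ⟨a, k, rfl⟩ := hrs r (by simp)
      rw [List.map_cons, List.flatten_cons, List.flatten_cons, wordInt_append, wordInt_append,
        ← Matrix.mul_assoc, ← Matrix.mul_assoc, resizeRun_replicate]
      refine ((hblock a K _ _ hK (modEq_four_mul_add_mod n (k + 1))).mul_right _).trans ?_
      exact ih _ (by rw [Matrix.det_mul, hK, wordInt_det, mul_one])
        (fun r hr => hrs r (List.mem_cons_of_mem _ hr))
  have := key (runs V) K hK (fun r hr => exists_eq_replicate_of_mem_runs hr)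
  rwa [flatten_runs] at this

/-! ### Periodic and skew-periodic words -/

theorem wordPow_succ' {α : Type*} (V : List α) (m : ℕ) :
    wordPow V (m + 1) = wordPow V m ++ V := by simp [wordPow, List.replicate_succ']

/-- A prefix of a power can be used to rotate the base of the power. -/
theorem exists_rotated_base {X Y : Word} {m : ℕ} (h : X <+: wordPow Y m) :
    ∃ U, Y ++ X = X ++ U ∧ ∀ k, wordPow Y k ++ X = X ++ wordPow U k := by
  obtain ⟨U, hU⟩ : X <+: Y ++ X := by
    have h₁ : X <+: wordPow Y (m + 1) := by
      rw [wordPow_succ']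
      exact h.trans (List.prefix_append _ _)
    have h₂ : Y ++ X <+: wordPow Y (m + 1) := by
      rw [wordPow_succ]
      exact (List.prefix_append_right_inj Y).2 h
    exact List.prefix_of_prefix_length_le h₁ h₂ (by simp)
  refine ⟨U, hU.symm, fun k => ?_⟩
  induction k with
  | zero => simp
  | succ k ih =>
    rw [wordPow_succ', List.append_assoc, ← hU, ← List.append_assoc, ih, List.append_assoc,
      wordPow_succ']

/-- The analogue of `exists_rotated_base` for words of the form `Y ++ assocWord Y`. -/
theorem exists_rotated_half {X Y : Word} (h : X <+: Y ++ assocWord Y) :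
    ∃ U, Y ++ assocWord X = X ++ U ∧ Y ++ assocWord Y ++ X = X ++ (U ++ assocWord U) := by
  obtain ⟨Z, hZ⟩ := h
  obtain ⟨U, hU⟩ : X <+: Y ++ assocWord X := by
    have h₁ : X <+: Y ++ assocWord Y ++ Y := by
      rw [← hZ, List.append_assoc]
      exact List.prefix_append _ _
    have h₂ : Y ++ assocWord X <+: Y ++ assocWord Y ++ Y := by
      rw [List.append_assoc, List.prefix_append_right_inj]
      refine ⟨assocWord Z, ?_⟩
      rw [← assocWord_append, hZ]
      simp
    exact List.prefix_of_prefix_length_le h₁ h₂ (by simp)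
  refine ⟨U, hU.symm, ?_⟩
  rw [← List.append_assoc X, hU, List.append_assoc Y (assocWord X), ← assocWord_append, hU]
  simp

theorem wordPow_left_injective {α : Type*} {U U' : List α} {m : ℕ} (hm : m ≠ 0)
    (h : wordPow U m = wordPow U' m) : U = U' := by
  obtain ⟨m, rfl⟩ := Nat.exists_eq_succ_of_ne_zero hm
  have hl := congrArg List.length h
  rw [length_wordPow, length_wordPow] at hl
  rw [wordPow_succ, wordPow_succ] at h
  exact (List.append_inj h (Nat.eq_of_mul_eq_mul_left m.succ_pos hl)).1

theorem append_assocWord_injective {U U' : Word}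
    (h : U ++ assocWord U = U' ++ assocWord U') : U = U' := by
  have hl := congrArg List.length h
  simp only [List.length_append, length_assocWord] at hl
  exact (List.append_inj h (by omega)).1

theorem kappa_wordPow (n : ℕ) {U : Word} {m : ℕ} {a : Letter}
    (h₁ : (wordPow U m).head? = some a) (h₂ : (wordPow U m).getLast? = some a.swap) :
    kappa n (wordPow U m) = wordPow (kappa n U) m := by
  have hU : U ≠ [] := by
    rintro rfl
    simp [wordPow] at h₁
  have h₁' : U.head? = some a := by
    cases m with
    | zero => simp at h₁
    | succ m =>
      rw [wordPow_succ, List.head?_append_of_ne_nil _ hU] at h₁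
      exact h₁
  have h₂' : U.getLast? = some a.swap := by
    cases m with
    | zero => simp at h₁
    | succ m =>
      rw [wordPow_succ', List.getLast?_append_of_ne_nil _ hU] at h₂
      exact h₂
  clear h₁ h₂
  induction m with
  | zero => rfl
  | succ m ih =>
    rw [wordPow_succ, wordPow_succ, kappa_append, ih]
    intro x hx y hy
    rw [h₂', Option.mem_some_iff] at hx
    have hy' : y = a := by
      cases m with
      | zero => simp at hy
      | succ m =>
        rw [wordPow_succ, List.head?_append_of_ne_nil _ hU, h₁', Option.mem_some_iff] at hy
        exact hy.symm
    rw [← hx, hy']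
    exact a.swap_ne

theorem head?_assocWord (U : Word) : (assocWord U).head? = U.head?.map Letter.swap := by
  simp [assocWord]

theorem getLast?_assocWord (U : Word) :
    (assocWord U).getLast? = U.getLast?.map Letter.swap := by
  simp [assocWord]

theorem kappa_append_assocWord (n : ℕ) {U : Word} {a : Letter}
    (h₁ : (U ++ assocWord U).head? = some a)
    (h₂ : (U ++ assocWord U).getLast? = some a.swap) :
    kappa n (U ++ assocWord U) = kappa n U ++ assocWord (kappa n U) := by
  have hU : U ≠ [] := by
    rintro rfl
    simp at h₁
  have hU' : assocWord U ≠ [] := by simpa [assocWord] using hU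
  rw [List.head?_append_of_ne_nil _ hU] at h₁
  rw [List.getLast?_append_of_ne_nil _ hU', getLast?_assocWord] at h₂
  rw [kappa_append, kappa_assocWord]
  intro x hx y hy
  rw [head?_assocWord, h₁] at hy
  rw [Option.mem_def.1 hx] at h₂
  have hx' : x.swap = a.swap := by simpa using h₂
  have hy' : a.swap = y := by simpa using hy
  rw [← hy', ← hx']
  exact x.swap_ne.symm

theorem mem_kappa {n : ℕ} (hn : 0 < n) {V : Word} {x : Letter} (h : x ∈ V) : x ∈ kappa n V := by
  rw [← flatten_runs V, List.mem_flatten] at h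
  obtain ⟨r, hr, hx⟩ := h
  obtain ⟨a, k, rfl⟩ := exists_eq_replicate_of_mem_runs hr
  exact List.mem_flatten.2 ⟨_, List.mem_map_of_mem hr, mem_resizeRun hn hx⟩

/-! ### Nonnegative roots -/

/-- A matrix in `SL₂(ℤ)` with trace at least two is nonnegative if some positive power of it is:
`A ^ m` is a positive multiple of `A` minus a multiple of the identity. -/
theorem nonneg_of_pow_nonneg {A : ZMat} (hA : A.det = 1) (ht : 2 ≤ A.trace) {m : ℕ} (hm : m ≠ 0)
    (h : ∀ i j, 0 ≤ (A ^ m) i j) : ∀ i j, 0 ≤ A i j := by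
  rw [Matrix.det_fin_two] at hA
  rw [Matrix.trace_fin_two] at ht
  have hsq : A * A = (A 0 0 + A 1 1) • A - (1 : ZMat) := by
    apply mat_ext <;> simp [Matrix.mul_apply, Fin.sum_univ_two, -zsmul_eq_mul]
    · linear_combination -hA
    · ring
    · ring
    · linear_combination -hA
  have key : ∀ k : ℕ, ∃ x y : ℤ, 0 ≤ y ∧ y < x ∧ A ^ (k + 1) = x • A - y • (1 : ZMat) := by
    intro k
    induction k with
    | zero => exact ⟨1, 0, le_rfl, one_pos, by simp⟩
    | succ k ih =>
      obtain ⟨x, y, hy, hyx, hk⟩ := ih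
      refine ⟨(A 0 0 + A 1 1) * x - y, x, by linarith, by nlinarith, ?_⟩
      rw [pow_succ, hk, Matrix.sub_mul, Matrix.smul_mul, Matrix.smul_mul, Matrix.one_mul, hsq]
      module
  obtain ⟨m, rfl⟩ := Nat.exists_eq_succ_of_ne_zero hm
  obtain ⟨x, y, hy, hyx, hk⟩ := key m
  have h₀₁ := h 0 1
  have h₁₀ := h 1 0
  rw [Nat.succ_eq_add_one, hk] at h₀₁ h₁₀
  simp [-zsmul_eq_mul] at h₀₁ h₁₀
  have hx : 0 < x := by linarith
  have h₁ : 0 ≤ A 0 1 := nonneg_of_mul_nonneg_right h₀₁ hx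
  have h₂ : 0 ≤ A 1 0 := nonneg_of_mul_nonneg_right h₁₀ hx
  have h₃ := mul_nonneg h₁ h₂
  have h₄ : 0 ≤ A 0 0 := by
    by_contra hc
    nlinarith
  have h₅ : 0 ≤ A 1 1 := by
    by_contra hc
    nlinarith
  simp only [Fin.forall_fin_two]
  exact ⟨⟨h₄, h₁⟩, h₂, h₅⟩

/-- The analogue of `nonneg_of_pow_nonneg` for the square root `A J` of `A * flip A`, where `J`
exchanges the coordinates. -/
theorem nonneg_of_mul_flip_nonneg {A : ZMat} (hA : A.det = 1) (ht : 0 < A 0 1 + A 1 0)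
    (h : ∀ i j, 0 ≤ (A * flip A) i j) : ∀ i j, 0 ≤ A i j := by
  rw [Matrix.det_fin_two] at hA
  have h₀₁ := h 0 1
  have h₁₀ := h 1 0
  simp [flip, Matrix.mul_apply, Fin.sum_univ_two] at h₀₁ h₁₀
  have h₁ : 0 ≤ A 0 0 := by
    by_contra hc
    nlinarith
  have h₂ : 0 ≤ A 1 1 := by
    by_contra hc
    nlinarith
  have h₃ := mul_nonneg h₁ h₂
  have h₄ : 0 ≤ A 0 1 := by
    by_contra hc
    nlinarith
  have h₅ : 0 ≤ A 1 0 := by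
    by_contra hc
    nlinarith
  simp only [Fin.forall_fin_two]
  exact ⟨⟨h₁, h₄⟩, h₅, h₂⟩

theorem mul_wordMat_eq_iff {M N : Mat} {V W : Word} :
    M * wordMat V = wordMat W * N ↔ toInt M * wordInt V = wordInt W * toInt N := by
  rw [← toInt_injective.eq_iff, toInt_mul, toInt_mul]
  rfl

theorem toInt_assocMat (M : Mat) : toInt (assocMat M) = flip (toInt M) := by
  apply mat_ext <;> simp [assocMat, flip]

theorem assocMat_assocMat (M : Mat) : assocMat (assocMat M) = M := by
  apply mat_ext <;> simp [assocMat]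

theorem assocMat_mul_wordMat_eq {M N : Mat} {V W : Word} (h : M * wordMat V = wordMat W * N) :
    assocMat M * wordMat (assocWord V) = wordMat (assocWord W) * assocMat N := by
  rw [mul_wordMat_eq_iff] at h ⊢
  rw [wordInt_assocWord, wordInt_assocWord, toInt_assocMat, toInt_assocMat, ← flip_mul,
    ← flip_mul, h]

theorem IsDB.assocMat {n : ℕ} {M : Mat} (h : IsDB n M) : IsDB n (assocMat M) := by
  obtain ⟨⟨hD, h₁, h₂⟩, _, h₃, h₄⟩ := h
  have hD' : IsD n (Raney.assocMat M) := by
    rw [isD_iff] at hD ⊢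
    rw [toInt_assocMat, flip_det]
    refine ⟨hD.1, fun k K' hk => hD.2 k (flip K') ?_⟩
    rw [← flip_flip (toInt M), hk]
    apply mat_ext <;> simp [flip]
  exact ⟨⟨hD', by simpa [Raney.assocMat] using h₂, by simpa [Raney.assocMat] using h₁⟩,
    hD', by simpa [Raney.assocMat] using h₄, by simpa [Raney.assocMat] using h₃⟩

/-- If a closed walk has the input word `V₁ ^ m` and `V₁` fixes the coset of its state, then
`V₁` is itself the input word of a closed walk. -/
theorem exists_wordMat_of_leftEquiv_pow {n : ℕ} (hn : 0 < n) {M : Mat} (hM : IsDB n M)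
    {V₁ W : Word} {m : ℕ} (hm : m ≠ 0) (hL : Letter.L ∈ V₁) (hR : Letter.R ∈ V₁)
    (h : M * wordMat (wordPow V₁ m) = wordMat W * M)
    (hfix : LeftEquiv (toInt M * wordInt V₁) (toInt M)) :
    ∃ W₁, M * wordMat V₁ = wordMat W₁ * M := by
  obtain ⟨A, hA, hAM⟩ := hfix
  have hdet : (toInt M).det ≠ 0 := by
    rw [((isD_iff n M).1 hM.1.1).1]
    exact_mod_cast hn.ne'
  have hpow : A ^ m = wordInt W := by
    rw [mul_wordMat_eq_iff, wordInt_wordPow, mul_pow_eq hAM] at h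
    have := congrArg (· * (toInt M).adjugate) h
    simp only [Matrix.mul_assoc, Matrix.mul_adjugate, Matrix.mul_smul, Matrix.mul_one] at this
    exact smul_right_injective _ hdet this
  have htr := (two_lt_trace_wordInt_iff V₁).2 ⟨hL, hR⟩
  rw [trace_eq_of_mul_eq hdet hAM] at htr
  obtain ⟨W₁, rfl⟩ := exists_eq_wordInt hA
    (nonneg_of_pow_nonneg hA htr.le hm fun i j => by rw [hpow]; simp [wordInt])
  exact ⟨W₁, mul_wordMat_eq_iff.2 hAM⟩

/-- If a closed walk has the input word `V₁ ++ assocWord V₁` and `V₁` leads from the coset of its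
state `M` to that of `assocMat M`, then `V₁` is the input word of a walk between these
states. -/
theorem exists_wordMat_of_leftEquiv_flip {n : ℕ} (hn : 0 < n) {M : Mat} (hM : IsDB n M)
    {V₁ W : Word} (hV₁ : V₁ ≠ []) (h : M * wordMat (V₁ ++ assocWord V₁) = wordMat W * M)
    (hfix : LeftEquiv (toInt M * wordInt V₁) (flip (toInt M))) :
    ∃ W₁, M * wordMat V₁ = wordMat W₁ * assocMat M := by
  obtain ⟨A, hA, hAM⟩ := hfix
  have hdet : (toInt M).det ≠ 0 := by
    rw [((isD_iff n M).1 hM.1.1).1]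
    exact_mod_cast hn.ne'
  have hsq : A * flip A = wordInt W := by
    rw [mul_wordMat_eq_iff, wordInt_append, wordInt_assocWord, ← Matrix.mul_assoc, hAM,
      Matrix.mul_assoc, ← flip_mul, hAM, flip_mul, flip_flip, ← Matrix.mul_assoc] at h
    have := congrArg (· * (toInt M).adjugate) h
    simp only [Matrix.mul_assoc, Matrix.mul_adjugate, Matrix.mul_smul, Matrix.mul_one] at this
    exact smul_right_injective _ hdet this
  have htr : 0 < A 0 1 + A 1 0 := by
    have hJ : ∀ K : ZMat, flip K = !![0, 1; 1, 0] * K * !![0, 1; 1, 0] := fun K => by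
      apply mat_ext <;> simp only [Matrix.mul_apply, Fin.sum_univ_two] <;> simp [flip]
    have hJJ : (!![0, 1; 1, 0] : ZMat) * !![0, 1; 1, 0] = 1 := by
      apply mat_ext <;> simp
    have e : toInt M * (wordInt V₁ * !![0, 1; 1, 0]) = A * !![0, 1; 1, 0] * toInt M := by
      rw [← Matrix.mul_assoc, hAM, hJ]
      simp only [Matrix.mul_assoc, hJJ, Matrix.mul_one]
    have := trace_eq_of_mul_eq hdet e
    simp only [Matrix.trace_fin_two, Matrix.mul_apply, Fin.sum_univ_two] at this
    simp at this
    rw [← this]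
    obtain ⟨x, t, rfl⟩ := List.exists_cons_of_ne_nil hV₁
    have h₁ := wordMat_offDiag_pos (V := x :: t)
    simp only [wordInt, toInt_apply]
    cases x
    · have := h₁.1 (by simp); omega
    · have := h₁.2 (by simp); omega
  obtain ⟨W₁, rfl⟩ := exists_eq_wordInt hA
    (nonneg_of_mul_flip_nonneg hA htr fun i j => by rw [hsq]; simp [wordInt])
  refine ⟨W₁, mul_wordMat_eq_iff.2 ?_⟩
  rw [hAM, toInt_assocMat]

/-! ### Closed walks -/

/-- An output word determined up to left equivalence is realized, up to rotation, by a closed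
walk through a genuine state, whose input word is a rotation of the given one. -/
theorem HasOutput.exists_state {n : ℕ} (hn : 0 < n) {K : ZMat} (hK : K.det = n)
    (hprim : IsPrimitive K) {V W : Word} (hL : Letter.L ∈ V) (hR : Letter.R ∈ V)
    (h : HasOutput K V W) :
    ∃ P Q M' W', V = P ++ Q ∧ IsDB n M' ∧ LeftEquiv (toInt M') (K * wordInt P) ∧
      M' * wordMat (Q ++ P) = wordMat W' * M' ∧ W' ~r W := by
  obtain ⟨T, hTK, hT⟩ := h
  have hdT : T.det = n := by rw [hTK.det_eq, hK]
  have hdT₀ : T.det ≠ 0 := by rw [hdT]; exact_mod_cast hn.ne'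
  have hW : W ≠ [] := by
    rintro rfl
    have := (two_lt_trace_wordInt_iff V).2 ⟨hL, hR⟩
    rw [trace_eq_of_mul_eq hdT₀ hT] at this
    simp at this
  obtain ⟨m, hm⟩ := exists_mul_pow_nonneg hdT₀ hL hR hW hT
  obtain ⟨X, hXK, hXV⟩ : ∃ X : Mat, LeftEquiv (toInt X) K ∧
      X * wordMat V = wordMat W * X := by
    have key : ∀ Y : ZMat, (∀ i j, 0 ≤ Y i j) → LeftEquiv Y K →
        Y * wordInt V = wordInt W * Y →
        ∃ X : Mat, LeftEquiv (toInt X) K ∧ X * wordMat V = wordMat W * X := by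
      intro Y hY hYK hYV
      have e : toInt (Y.map Int.toNat) = Y := by
        ext i j
        simp [hY i j]
      exact ⟨Y.map Int.toNat, by rwa [e], by rwa [mul_wordMat_eq_iff, e]⟩
    have h₁ : LeftEquiv (T * wordInt V ^ m) K := by
      rw [mul_pow_eq hT, ← wordInt_wordPow]
      exact (LeftEquiv.of_mul_left (wordInt_det _) T).trans hTK
    have h₂ : T * wordInt V ^ m * wordInt V = wordInt W * (T * wordInt V ^ m) := by
      rw [Matrix.mul_assoc, ← pow_succ, pow_succ', ← Matrix.mul_assoc, hT, Matrix.mul_assoc]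
    rcases hm with hm | hm
    · exact key _ hm h₁ h₂
    · exact key (-(T * wordInt V ^ m)) (fun i j => by simpa using hm i j)
        ((LeftEquiv.neg _).trans h₁) (by rw [Matrix.neg_mul, h₂, Matrix.mul_neg])
  have hXD : IsD n X := (isD_iff n X).2 ⟨by rw [hXK.det_eq, hK], hXK.isPrimitive hprim⟩
  obtain ⟨W₀, N, rfl, hN⟩ := hXD.exists_wordMat_mul hn
  obtain ⟨W₁, N₁, hN₁, hN₁RB⟩ := (hN.1.mul_wordMat V).exists_wordMat_mul hn
  obtain ⟨hWW, rfl⟩ := wordMat_mul_rowBalanced_unique hN₁RB.2 hN.2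
    (W := W₀ ++ W₁) (W' := W ++ W₀) (by
      rw [wordMat_append, wordMat_append, Matrix.mul_assoc, ← hN₁, ← Matrix.mul_assoc, hXV,
        Matrix.mul_assoc])
  have hW₁ : W₁ ≠ [] := by
    rintro rfl
    have := congrArg List.length hWW
    simp only [List.length_append, List.length_nil] at this
    exact hW (List.length_eq_zero_iff.1 (by omega))
  obtain ⟨P, Q, W₂, M', rfl, -, hP, hM', -⟩ := exists_first_exit hn hN (V := V) (by
    rw [hN₁]
    exact fun h => not_rowBalanced_wordMat_mul hW₁ _ h.2)
  obtain ⟨W₃, N₃, hN₃, hN₃RB⟩ := (hM'.1.1.mul_wordMat (Q ++ P)).exists_wordMat_mul hn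
  obtain ⟨hWW', rfl⟩ := wordMat_mul_rowBalanced_unique hN₃RB.2 hM'.1.2
    (W := W₂ ++ W₃) (W' := W₁ ++ W₂) (by
      rw [wordMat_append W₂, Matrix.mul_assoc, ← hN₃, ← Matrix.mul_assoc, ← hP,
        wordMat_append Q, Matrix.mul_assoc N₁, ← Matrix.mul_assoc (wordMat P),
        ← wordMat_append, ← Matrix.mul_assoc, hN₁, Matrix.mul_assoc, hP, ← Matrix.mul_assoc,
        ← wordMat_append])
  refine ⟨P, Q, N₃, W₃, rfl, hM', ?_, hN₃,
    (isRotated_of_append_eq_append hWW').trans (isRotated_of_append_eq_append hWW)⟩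
  have h₁ : LeftEquiv (toInt N₃) (toInt N₁ * wordInt P) := by
    rw [mul_wordMat_eq_iff.1 hP]
    exact (LeftEquiv.of_mul_left (wordInt_det W₂) _).symm
  have h₂ : LeftEquiv (toInt N₁) K := by
    rw [toInt_mul] at hXK
    exact (LeftEquiv.of_mul_left (wordInt_det W₀) _).symm.trans hXK
  exact h₁.trans (h₂.mul_right _)

/-- If the base of `V' = U ^ m`, resized and rotated, fixes the coset of the new state, then the
base of the power `V` fixes the coset of the old one. -/
theorem leftEquiv_of_pow {n : ℕ} {K K' : ZMat} (hK : K.det = n) {V₁ V₁' Va Vb P Q : Word}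
    {m : ℕ} (hm : m ≠ 0) {a : Letter} (hV : Va ++ Vb = wordPow V₁ m)
    (h₁ : (Vb ++ Va).head? = some a) (h₂ : (Vb ++ Va).getLast? = some a.swap)
    (hPQ : kappa n (Vb ++ Va) = P ++ Q) (hQP : Q ++ P = wordPow V₁' m)
    (hK' : LeftEquiv K' (K * wordInt Va * wordInt P)) (hfix : LeftEquiv (K' * wordInt V₁') K') :
    LeftEquiv (K * wordInt V₁) K := by
  obtain ⟨U, hU, hUk⟩ := exists_rotated_base (X := Va) (Y := V₁) (m := m) ⟨Vb, hV⟩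
  have hVU : Vb ++ Va = wordPow U m := by
    have := hUk m
    rw [← hV, List.append_assoc] at this
    exact List.append_cancel_left this
  rw [hVU] at h₁ h₂ hPQ
  rw [kappa_wordPow n h₁ h₂] at hPQ
  obtain ⟨U', hU', hU'k⟩ := exists_rotated_base (X := P) (Y := kappa n U) (m := m)
    ⟨Q, hPQ.symm⟩
  obtain rfl : U' = V₁' := by
    have := hU'k m
    rw [hPQ, List.append_assoc, hQP] at this
    exact (wordPow_left_injective hm (List.append_cancel_left this)).symm
  have e₁ : LeftEquiv (K * wordInt Va * wordInt (kappa n U) * wordInt P)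
      (K * wordInt Va * wordInt P) := by
    rw [Matrix.mul_assoc _ (wordInt (kappa n U)), ← wordInt_append, hU', wordInt_append,
      ← Matrix.mul_assoc]
    exact (hK'.mul_right _).symm.trans (hfix.trans hK')
  have e₂ := e₁.of_mul_right (wordInt_det P)
  have hdet : (K * wordInt Va).det = n := by rw [Matrix.det_mul, wordInt_det, hK, mul_one]
  have e₃ := (leftEquiv_mul_kappa hdet U).symm.trans e₂
  rw [Matrix.mul_assoc, ← wordInt_append, ← hU, wordInt_append, ← Matrix.mul_assoc] at e₃
  exact e₃.of_mul_right (wordInt_det Va)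

/-- The analogue of `leftEquiv_of_pow` for symmetric walks. -/
theorem leftEquiv_of_symmetric {n : ℕ} {K K' : ZMat} (hK : K.det = n)
    {V₁ V₁' Va Vb P Q : Word} {a : Letter} (hV : Va ++ Vb = V₁ ++ assocWord V₁)
    (h₁ : (Vb ++ Va).head? = some a) (h₂ : (Vb ++ Va).getLast? = some a.swap)
    (hPQ : kappa n (Vb ++ Va) = P ++ Q) (hQP : Q ++ P = V₁' ++ assocWord V₁')
    (hK' : LeftEquiv K' (K * wordInt Va * wordInt P))
    (hfix : LeftEquiv (K' * wordInt V₁') (flip K')) :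
    LeftEquiv (K * wordInt V₁) (flip K) := by
  obtain ⟨U, hU, hUk⟩ := exists_rotated_half (X := Va) (Y := V₁) ⟨Vb, hV⟩
  have hVU : Vb ++ Va = U ++ assocWord U := by
    rw [← hV, List.append_assoc] at hUk
    exact List.append_cancel_left hUk
  rw [hVU] at h₁ h₂ hPQ
  rw [kappa_append_assocWord n h₁ h₂] at hPQ
  obtain ⟨U', hU', hU'k⟩ := exists_rotated_half (X := P) (Y := kappa n U) ⟨Q, hPQ.symm⟩
  obtain rfl : U' = V₁' := by
    rw [hPQ, List.append_assoc, hQP] at hU'k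
    exact (append_assocWord_injective (List.append_cancel_left hU'k)).symm
  have e₁ : LeftEquiv (K * wordInt Va * wordInt (kappa n U) * wordInt (assocWord P))
      (flip (K * wordInt Va) * wordInt (assocWord P)) := by
    rw [Matrix.mul_assoc _ (wordInt (kappa n U)), ← wordInt_append, hU', wordInt_append,
      ← Matrix.mul_assoc, wordInt_assocWord, ← flip_mul]
    exact (hK'.mul_right _).symm.trans (hfix.trans hK'.flip)
  have e₂ := e₁.of_mul_right (wordInt_det _)
  have hdet : (K * wordInt Va).det = n := by rw [Matrix.det_mul, wordInt_det, hK, mul_one]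
  have e₃ := (leftEquiv_mul_kappa hdet U).symm.trans e₂
  rw [Matrix.mul_assoc, ← wordInt_append, ← hU, wordInt_append, ← Matrix.mul_assoc, flip_mul,
    ← wordInt_assocWord] at e₃
  exact e₃.of_mul_right (wordInt_det _)

/-! ### Input words with a single letter -/

theorem cyclicRunCount_replicate (k : ℕ) (x : Letter) :
    cyclicRunCount (List.replicate (k + 1) x) = 1 := by
  have h : conjugates (List.replicate (k + 1) x) = {List.replicate (k + 1) x} := by
    ext w
    constructor
    · rintro ⟨m, rfl⟩
      simp
    · rintro rfl
      exact List.IsRotated.refl _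
  rw [cyclicRunCount, h, Set.image_singleton, csInf_singleton]
  simp [runCount, runs_replicate]

theorem exists_output_replicate_L {n : ℕ} (hn : 0 < n) {M : Mat} (hM : IsDB n M) {W : Word}
    {k k' : ℕ} (h : M * wordMat (List.replicate (k + 1) Letter.L) = wordMat W * M)
    (hk' : 0 < k') (hkk' : k + 1 ≡ k' [MOD n]) :
    ∃ m m', W = List.replicate (m + 1) Letter.L ∧
      M * wordMat (List.replicate k' Letter.L) =
        wordMat (List.replicate (m' + 1) Letter.L) * M := by
  have hD := (isD_iff n M).1 hM.1.1
  have hdet : (toInt M).det ≠ 0 := by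
    rw [hD.1]
    exact_mod_cast hn.ne'
  have hpos := hM.1.2
  have hM₁₁ : 0 < M 1 1 := (Nat.zero_le _).trans_lt hpos.2
  have htr : ¬ (Letter.L ∈ W ∧ Letter.R ∈ W) := by
    rw [← two_lt_trace_wordInt_iff, ← trace_eq_of_mul_eq hdet (mul_wordMat_eq_iff.1 h),
      two_lt_trace_wordInt_iff]
    simp
  have e := fun i j => congrFun (congrFun h i) j
  have e₀ := e 0 0
  have e₂ := e 1 0
  simp only [wordMat_replicate_L] at e₀ e₂
  by_cases hL : Letter.L ∈ W
  · have hR : Letter.L.swap ∉ W := fun hR => htr ⟨hL, hR⟩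
    rw [eq_replicate_of_swap_notMem hR, wordMat_replicate_L] at e₀ e₂
    simp [Matrix.mul_apply, Fin.sum_univ_two] at e₀ e₂
    have hW := List.length_pos_of_mem hL
    have hn' : M 0 0 * M 1 1 = n := by
      have := hD.1
      rw [Matrix.det_fin_two] at this
      simp only [toInt_apply, e₀] at this
      push_cast at this
      zify
      linarith
    obtain ⟨t, ht⟩ := (Nat.modEq_iff_dvd.1 hkk' : (n : ℤ) ∣ k' - (k + 1 : ℕ))
    obtain ⟨c, hc⟩ : M 0 0 ∣ k' * M 1 1 := by
      zify
      refine ⟨W.length + M 1 1 ^ 2 * t, ?_⟩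
      zify at hn' e₂
      push_cast at ht
      have e₄ : ((k : ℤ) + 1) * M 1 1 = W.length * M 0 0 := by linarith
      linear_combination (M 1 1 : ℤ) * ht + e₄ - t * (M 1 1 : ℤ) * hn'
    have hc₀ : 0 < c := by
      rcases Nat.eq_zero_or_pos c with rfl | hc₀
      · exact absurd hc (Nat.mul_pos hk' hM₁₁).ne'
      · exact hc₀
    refine ⟨W.length - 1, c - 1, ?_, ?_⟩
    · rw [Nat.sub_add_cancel hW]
      exact eq_replicate_of_swap_notMem hR
    · rw [Nat.sub_add_cancel hc₀, wordMat_replicate_L, wordMat_replicate_L]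
      apply mat_ext <;> simp [Matrix.mul_apply, Fin.sum_univ_two, e₀]
      rw [mul_comm (M 1 1), hc]
      ring
  · rw [eq_replicate_of_swap_notMem (x := Letter.R) hL, wordMat_replicate_R] at e₂
    simp [Matrix.mul_apply, Fin.sum_univ_two] at e₂
    omega

theorem exists_output_replicate {n : ℕ} (hn : 0 < n) {M : Mat} (hM : IsDB n M) {W : Word}
    {k k' : ℕ} {x : Letter} (h : M * wordMat (List.replicate (k + 1) x) = wordMat W * M)
    (hk' : 0 < k') (hkk' : k + 1 ≡ k' [MOD n]) :
    ∃ m m', W = List.replicate (m + 1) x ∧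
      M * wordMat (List.replicate k' x) = wordMat (List.replicate (m' + 1) x) * M := by
  cases x
  · exact exists_output_replicate_L hn hM h hk' hkk'
  · have h' := assocMat_mul_wordMat_eq h
    rw [assocWord_replicate] at h'
    obtain ⟨m, m', hW, hm'⟩ := exists_output_replicate_L hn hM.assocMat h' hk' hkk'
    refine ⟨m, m', ?_, ?_⟩
    · rw [← assocWord_assocWord W, hW, assocWord_replicate]
      rfl
    · have := assocMat_mul_wordMat_eq hm'
      rwa [assocWord_replicate, assocWord_replicate, assocMat_assocMat] at this

theorem mem_assocWord_append {V₁ : Word} (h : V₁ ++ assocWord V₁ ≠ []) (x : Letter) :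
    x ∈ V₁ ++ assocWord V₁ := by
  cases V₁ with
  | nil => simp at h
  | cons y t =>
    by_cases hxy : y = x
    · simp [hxy]
    · simp [Letter.eq_swap_of_ne hxy]

end Raney

/-! ### Closed walks with resized runs -/

theorem mainTheorem3 (n : ℕ) (hn : 0 < n) (M : Raney.Mat) (C : List Raney.Transition)
    (V W : Raney.Word) (hC : Raney.IsWalk n M C M) (hV : Raney.inputWord C = V)
    (hW : Raney.outputWord C = W) (hV0 : V ≠ []) :
    ∃ V' ∈ Raney.tauKappa n V,
      ∃ (M' : Raney.Mat) (C' : List Raney.Transition) (W' : Raney.Word),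
        Raney.IsDB n M' ∧ Raney.IsWalk n M' C' M' ∧
        Raney.inputWord C' = V' ∧ Raney.outputWord C' = W' ∧
        Raney.cyclicRunCount W ≤ Raney.cyclicRunCount W' ∧
        (Raney.Letter.L ∈ V → Raney.Letter.R ∈ V →
          ∀ (m₁ : ℕ) (V₁ : Raney.Word), 2 ≤ m₁ → V = Raney.wordPow V₁ m₁ →
          ∀ C₁' : List Raney.Transition, Raney.IsWalk n M' C₁' M' →
            C' = Raney.wordPow C₁' m₁ →
          ∃ (m₂ : ℕ) (C₂ : List Raney.Transition), 2 ≤ m₂ ∧ Raney.IsWalk n M C₂ M ∧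
            C = Raney.wordPow C₂ m₂ ∧
            V = Raney.wordPow (Raney.inputWord C₂) m₂ ∧
            W = Raney.wordPow (Raney.outputWord C₂) m₂) ∧
        ((∃ V₁ : Raney.Word, V = V₁ ++ Raney.assocWord V₁) →
          Raney.IsSymmetricClosedWalk n M' C' → Raney.IsSymmetricClosedWalk n M C) := by
  open Raney in
  have hM := hC.isDB_left
  have hD := (isD_iff n M).1 hM.1.1
  have hMV : M * wordMat V = wordMat W * M := by rw [← hV, ← hW]; exact hC.mul_eq
  have hdet : ∀ {N : Mat}, IsDB n N → (toInt N).det ≠ 0 := fun hN => by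
    rw [((isD_iff n _).1 hN.1.1).1]
    exact_mod_cast hn.ne'
  by_cases hLR : Letter.L ∈ V ∧ Letter.R ∈ V
  -- After a rotation the first and last letters of the input differ, so that its runs are the
  -- runs of the cyclic word.
  · obtain ⟨hL, hR⟩ := hLR
    obtain ⟨Va, Vb, a, hVab, h₁, h₂⟩ := exists_rotation_head_ne_getLast hL hR
    have hrot : V ~r (Vb ++ Va) := hVab ▸ List.isRotated_append
    have hdetVa : (toInt M * wordInt Va).det = n := by
      rw [Matrix.det_mul, wordInt_det, hD.1, mul_one]
    have hout : HasOutput (toInt M * wordInt Va) (Vb ++ Va) W := by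
      rw [← HasOutput.rotate, ← hVab]
      exact ⟨toInt M, LeftEquiv.refl _, mul_wordMat_eq_iff.1 hMV⟩
    have hL' := hrot.mem_iff.1 hL
    have hR' := hrot.mem_iff.1 hR
    obtain ⟨W₀, hW₀, hle⟩ := hout.kappa hn hdetVa hL' hR'
    obtain ⟨P, Q, M', W', hPQ, hM', hM'K, hM'W', hW'⟩ := hW₀.exists_state hn hdetVa
      (hD.2.mul_right (wordInt_det Va)) (mem_kappa hn hL') (mem_kappa hn hR')
    obtain ⟨C', hC', hCV', hCW'⟩ := exists_walk hn hM' hM' hM'W'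
    refine ⟨Q ++ P, ⟨Vb ++ Va, hrot, ?_, ?_⟩, M', C', W', hM', hC', hCV', hCW', ?_, ?_, ?_⟩
    · rw [runCount_eq_cyclicChanges h₁ h₂, cyclicRunCount_eq_cyclicChanges hL hR,
        cyclicChanges_eq_of_isRotated hrot]
    · rw [hPQ]
      exact List.isRotated_append
    · have htr : ∀ {N : Mat} {X Y : Word}, IsDB n N → N * wordMat X = wordMat Y * N →
          Letter.L ∈ X → Letter.R ∈ X → cyclicRunCount Y = cyclicChanges Y := by
        intro N X Y hN hXY hXL hXR
        have := (two_lt_trace_wordInt_iff X).2 ⟨hXL, hXR⟩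
        rw [trace_eq_of_mul_eq (hdet hN) (mul_wordMat_eq_iff.1 hXY),
          two_lt_trace_wordInt_iff] at this
        exact cyclicRunCount_eq_cyclicChanges this.1 this.2
      have hmem : ∀ x ∈ Vb ++ Va, x ∈ Q ++ P := fun x hx => by
        have := mem_kappa hn hx
        rw [hPQ] at this
        exact List.isRotated_append.mem_iff.1 this
      rw [htr hM hMV hL hR, htr hM' hM'W' (hmem _ hL') (hmem _ hR'),
        cyclicChanges_eq_of_isRotated hW']
      exact hle
    · rintro - - m V₁ hm hV₁ C₁' hC₁' rfl
      rw [inputWord_wordPow] at hCV'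
      have hm₀ : m ≠ 0 := by omega
      have hfix' : LeftEquiv (toInt M' * wordInt (inputWord C₁')) (toInt M') := by
        rw [mul_wordMat_eq_iff.1 hC₁'.mul_eq]
        exact LeftEquiv.of_mul_left (wordInt_det _) _
      have hfix := leftEquiv_of_pow hD.1 hm₀ (hVab ▸ hV₁) h₁ h₂ hPQ hCV'.symm hM'K hfix'
      have hmem : ∀ x ∈ V, x ∈ V₁ := fun x hx => by
        rw [hV₁, wordPow, List.mem_flatten] at hx
        obtain ⟨l, hl, hx⟩ := hx
        exact List.eq_of_mem_replicate hl ▸ hx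
      obtain ⟨W₁, hW₁⟩ := exists_wordMat_of_leftEquiv_pow hn hM hm₀ (hmem _ hL) (hmem _ hR)
        (hV₁ ▸ hMV) hfix
      obtain ⟨C₂, hC₂, hC₂V, -⟩ := exists_walk hn hM hM hW₁
      have hCC : C = wordPow C₂ m := hC.eq_of_inputWord_eq (hC₂.wordPow m)
        (by rw [inputWord_wordPow, hC₂V, hV, hV₁])
      exact ⟨m, C₂, hm, hC₂, hCC, by rw [hC₂V, hV₁],
        by rw [← hW, hCC, outputWord_wordPow]⟩
    · rintro ⟨V₁, hV₁⟩ ⟨C₁', C₂', rfl, hC₁', hC₂', hsym⟩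
      rw [inputWord_append, hsym] at hCV'
      have hfix' : LeftEquiv (toInt M' * wordInt (inputWord C₁')) (Raney.flip (toInt M')) := by
        rw [mul_wordMat_eq_iff.1 hC₁'.mul_eq, ← toInt_assocMat]
        exact LeftEquiv.of_mul_left (wordInt_det _) _
      have hfix := leftEquiv_of_symmetric hD.1 (hVab ▸ hV₁) h₁ h₂ hPQ hCV'.symm hM'K hfix'
      have hV₁0 : V₁ ≠ [] := by
        rintro rfl
        exact hV0 hV₁
      obtain ⟨W₁, hW₁⟩ := exists_wordMat_of_leftEquiv_flip hn hM hV₁0 (hV₁ ▸ hMV) hfix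
      have hW₁' := assocMat_mul_wordMat_eq hW₁
      rw [assocMat_assocMat] at hW₁'
      obtain ⟨C₁, hC₁, hC₁V, -⟩ := exists_walk hn hM hM.assocMat hW₁
      obtain ⟨C₂, hC₂, hC₂V, -⟩ := exists_walk hn hM.assocMat hM hW₁'
      refine ⟨C₁, C₂, hC.eq_of_inputWord_eq (hC₁.append hC₂) ?_, hC₁, hC₂, by rw [hC₂V, hC₁V]⟩
      rw [inputWord_append, hC₁V, hC₂V, hV, hV₁]
  -- If `V` is a power of a letter, then so is `W`, and the same state reads the resized run.
  · obtain ⟨x, k, rfl⟩ : ∃ x k, V = List.replicate (k + 1) x := by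
      have hlen : V.length - 1 + 1 = V.length :=
        Nat.sub_add_cancel (List.length_pos_iff.2 hV0)
      by_cases hL : Letter.L ∈ V
      · exact ⟨Letter.L, V.length - 1,
          by rw [hlen]; exact eq_replicate_of_swap_notMem fun hR => hLR ⟨hL, hR⟩⟩
      · exact ⟨Letter.R, V.length - 1, by rw [hlen]; exact eq_replicate_of_swap_notMem hL⟩
    obtain ⟨m, m', rfl, hm'⟩ := exists_output_replicate hn hM hMV (k' := 4 * n + (k + 1) % n)
      (by omega) (modEq_four_mul_add_mod n (k + 1))
    obtain ⟨C', hC', hCV', hCW'⟩ := exists_walk hn hM hM hm'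
    refine ⟨List.replicate (4 * n + (k + 1) % n) x,
      ⟨List.replicate (k + 1) x, List.IsRotated.refl _, ?_, ?_⟩, M, C', _, hM, hC', hCV', hCW',
      ?_, ?_, ?_⟩
    · rw [cyclicRunCount_replicate]
      simp [runCount, runs_replicate]
    · rw [kappa_replicate]
      exact List.IsRotated.refl _
    · rw [cyclicRunCount_replicate, cyclicRunCount_replicate]
    · exact fun hL hR => absurd ⟨hL, hR⟩ hLR
    · rintro ⟨V₁, hV₁⟩
      rw [hV₁] at hV0 hLR
      exact absurd ⟨mem_assocWord_append hV0 _, mem_assocWord_append hV0 _⟩ hLR
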